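/- Definitions. For $A\subseteq\omega$ put $\rho_n(A)=|A\cap\{0,\dots,n-1\}|/n$, $\overline\rho(A)=\limsup_n\rho_n(A)$, $\underline\rho(A)=\liminf_n\rho_n(A)$; $A$ has density $\alpha$ if $\overline\rho(A)=\underline\rho(A)=\alpha$. $A$ is *intrinsically small* if $\sup_f\overline\rho(f^{-1}(A))=\inf_f\underline\rho(f^{-1}(A))=0$, where $f$ ranges over the total computable injections $\omega\to\omega$. A *skip sequence* is a finite sequence $\sigma\in(\omega\times\{0,1\})^{<\omega}$ with strictly increasing first coordinates. A *skip rule* is a total function $f$ from skip sequences to $\omega$ such that $f(\sigma)$ exceeds the first coordinate of the last entry of $\sigma$ (if $\sigma\neq\emptyset$). Playing $f$ against $A$ produces the doors $d_n=f\big((d_0,A(d_0)),\dots,(d_{n-1},A(d_{n-1}))\big)$, and $f(A)=\{n: d_n\in A\}$. $A$ is *$\alpha$-weakly stochastic* if $f(A)$ has density $\alpha$ for every computable skip rule $f$. A *contestant* assigns to $X\subseteq\omega$ and $x\in\omega$ the $x$-th door $g(X,x)\in\omega$ that it opens if $X$ is the set of doors with cars. It is *computable* if $(\sigma,x)\mapsto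 g(X_\sigma,x)$ is a total computable function on $2^{<\omega}\times\omega$, where $X_\sigma$ is the finite set with characteristic function $\sigma 000\dots$; *orderly* if $g(X,x)<g(X,x+1)$ for all $X,x$; and *consistent* if for all $X,Y,x$: whenever $X$ and $Y$ agree on the doors $g(X,y)$, $y<x$, then $g(X,x)=g(Y,x)$. $A$ *beats* $g$ if $\{x: g(A,x)\in A\}$ has density $0$. The function $h$. For $s,l,t,d\in\omega$ define the finite sequence $\mathrm{DB}_s(l,t,d)$ of doors, thought of as opened at times $t,t+1,\dots$, by recursion on $l$. Let $m=(t+s^3)s+1$. Put $\mathrm{DB}_s(0,t,d)=(d,d+1,\dots,d+m-1)$. For $l\ge 1$ put $t_0=t+m$, $e_0=d$ and, for $0\le i<m$, $\mathrm{SB}_i=\mathrm{DB}_s(l-1,t_i,e_i+1)$, $t_{i+1}=t_i+|\mathrm{SB}_i|$, $e_{i+1}=e_i+|\mathrm{SB}_i|+1$; then $\mathrm{DB}_s(l,t,d)=(e_0,\dots,e_{m-1})^\frown\mathrm{SB}_0{}^\frown\cdots^\frown\mathrm{SB}_{m-1}$. Let $h:\omega\to\omega$ be the infinite concatenation $\mathrm{DB}^0{}^\frown\mathrm{DB}^1{}^\frown\mathrm{DB}^2{}^\frown\cdots$,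 where $\mathrm{DB}^s=\mathrm{DB}_s(s,a_s,a_s)$ and $a_s=\sum_{r<s}|\mathrm{DB}^r|$. Theorem. The function $h$ is computable and injective, and there is an infinite set $A\subseteq\omega$ with $A\le_T\emptyset'$ such that 1. $A$ beats every computable, orderly, consistent contestant, and $A$ is $0$-weakly stochastic; 2. $\overline\rho(h^{-1}(A))=1$; in particular $A$ is not intrinsically small. -/

import Mathlib

namespace Stochasticity

noncomputable section

/-! ### Density -/

open Classical in
/-- The density of `A` at `n`: the proportion of elements of `A` among `0, …, n - 1`. -/
def densityAt (A : Set ℕ) (n : ℕ) : ℝ :=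
  (((Finset.range n).filter (fun k => k ∈ A)).card : ℝ) / (n : ℝ)

/-- The upper (asymptotic) density. -/
def upperDensity (A : Set ℕ) : ℝ := Filter.limsup (densityAt A) Filter.atTop

/-- The lower (asymptotic) density. -/
def lowerDensity (A : Set ℕ) : ℝ := Filter.liminf (densityAt A) Filter.atTop

/-- `A` has (asymptotic) density `α`. -/
def HasDensity (A : Set ℕ) (α : ℝ) : Prop := upperDensity A = α ∧ lowerDensity A = α

/-! ### Intrinsic density: disorderly, non-adaptive contestants

A contestant is a computable injection `f`, opening door `f t` at time `t`. -/

/-- The supremum of the upper densities of `f⁻¹(A)` over all total computable injections `f`. -/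
def intrinsicUpperDensity (A : Set ℕ) : ℝ :=
  sSup {r : ℝ | ∃ f : ℕ → ℕ, Computable f ∧ Function.Injective f ∧ r = upperDensity (f ⁻¹' A)}

/-- The infimum of the lower densities of `f⁻¹(A)` over all total computable injections `f`. -/
def intrinsicLowerDensity (A : Set ℕ) : ℝ :=
  sInf {r : ℝ | ∃ f : ℕ → ℕ, Computable f ∧ Function.Injective f ∧ r = lowerDensity (f ⁻¹' A)}

/-- `A` has intrinsic density `α`. -/
def HasIntrinsicDensity (A : Set ℕ) (α : ℝ) : Prop :=
  intrinsicUpperDensity A = α ∧ intrinsicLowerDensity A = α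

/-- `A` is intrinsically small: it has intrinsic density `0`. -/
def IntrinsicallySmall (A : Set ℕ) : Prop := HasIntrinsicDensity A 0

/-! ### Weak stochasticity: orderly, weakly adaptive contestants as skip rules -/

/-- A skip sequence: a finite list of pairs (door opened, was there a car?) whose doors are
strictly increasing. -/
def IsSkipSequence (σ : List (ℕ × Bool)) : Prop := σ.Pairwise (fun a b => a.1 < b.1)

/-- A skip rule selects, after every skip sequence, a door beyond the last one opened. (The set of
skip sequences is decidable, so a computable function on skip sequences is the same thing as the
restriction of a computable function on all lists; values elsewhere are irrelevant.) -/
def IsSkipRule (f : List (ℕ × Bool) → ℕ) : Prop :=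
  ∀ σ, IsSkipSequence σ → ∀ p ∈ σ.getLast?, p.1 < f σ

open Classical in
/-- The skip sequence consisting of the first `n` doors opened by the skip rule `f` playing against
`A`, with what was behind them. -/
def skipPlay (f : List (ℕ × Bool) → ℕ) (A : Set ℕ) : ℕ → List (ℕ × Bool)
  | 0 => []
  | n + 1 => skipPlay f A n ++ [(f (skipPlay f A n), decide (f (skipPlay f A n) ∈ A))]

/-- The set `f(A)` of times `n` at which the skip rule `f` playing against `A` receives a car. -/
def skipSelect (f : List (ℕ × Bool) → ℕ) (A : Set ℕ) : Set ℕ := {n | f (skipPlay f A n) ∈ A}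

/-- `A` is `α`-weakly stochastic. -/
def WeaklyStochastic (α : ℝ) (A : Set ℕ) : Prop :=
  ∀ f : List (ℕ × Bool) → ℕ, Computable f → IsSkipRule f → HasDensity (skipSelect f A) α

/-! ### Orderly, weakly adaptive contestants as functionals

`g X x` is the `x`-th door opened by the contestant `g` if the doors that contain cars are exactly
those in `X`. -/

/-- The finite set whose characteristic function is the binary string `σ` followed by zeros. -/
def ofString (σ : List Bool) : Set ℕ := {d | σ.getD d false = true}

/-- Each door opened exceeds the previous one. -/
def Orderly (g : Set ℕ → ℕ → ℕ) : Prop := ∀ X x, g X x < g X (x + 1)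

/-- The next door opened depends only on the contents of the doors opened earlier. -/
def Consistent (g : Set ℕ → ℕ → ℕ) : Prop :=
  ∀ X Y x, (∀ y < x, (g X y ∈ X ↔ g X y ∈ Y)) → g X x = g Y x

/-- `g` is given by a total computable function `2^{<ω} × ω → ω`, a binary string being read as
the finite set that it codes. An orderly, consistent `g` is determined by its values on finite sets:
`g X x = g (X ∩ [0, n)) x` as soon as `n` exceeds the first `x` doors opened. -/
def ComputableContestant (g : Set ℕ → ℕ → ℕ) : Prop :=
  Computable₂ (fun (σ : List Bool) (x : ℕ) => g (ofString σ) x)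

/-- The host `A` beats the contestant `g`: the proportion of cars received by `g` tends to `0`. -/
def BeatsContestant (A : Set ℕ) (g : Set ℕ → ℕ → ℕ) : Prop := HasDensity {x | g A x ∈ A} 0

/-! ### The halting problem and Turing reducibility of sets -/

open Classical in
/-- The characteristic function of a set, as a (total) partial function. -/
def charFun (A : Set ℕ) : ℕ →. ℕ := fun n => Part.some (if n ∈ A then 1 else 0)

/-- The halting problem `∅′`: the indices `e` such that the `e`-th partial computable function
halts on `e`. -/
def haltingSet : Set ℕ :=
  {e | (Nat.Partrec.Code.eval (Denumerable.ofNat Nat.Partrec.Code e) e).Dom}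

/-- `A ≤_T B` for sets of natural numbers. -/
def SetTuringReducible (A B : Set ℕ) : Prop := TuringReducible (charFun A) (charFun B)

end

/-! ### The injection built from nested disordered blocks

A block starting at time `t` is represented by the list of the doors opened at times
`t, t + 1, …`. -/

/-- The length of the increasing part of a block with parameter `s` that starts at time `t`. -/
def incSize (s t : ℕ) : ℕ := (t + s ^ 3) * s + 1

/-- Given `sub t d`, the sub-block starting at time `t` with first door `d`, lay out `k` groups of
doors, from door `e` on, each consisting of one door of the increasing part followed by the doors of
a sub-block. The sub-blocks are carried out one after the other from time `t` on. Returns the list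
of the doors of the increasing part and the concatenation of the sub-blocks. -/
def layOut (sub : ℕ → ℕ → List ℕ) : ℕ → ℕ → ℕ → List ℕ × List ℕ
  | 0, _, _ => ([], [])
  | k + 1, t, e =>
    let b := sub t (e + 1)
    let r := layOut sub k (t + b.length) (e + b.length + 1)
    (e :: r.1, b ++ r.2)

/-- The disordered block with parameter `s`, of level `l`, with starting time `t` and first door `d`.
At level `0` it is a translation. At level `l + 1` it starts with its increasing part, which opens
the door just before each sub-block of level `l`, and then goes through the sub-blocks. -/
def disorderedBlock (s : ℕ) : ℕ → ℕ → ℕ → List ℕ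
  | 0, t, d => List.range' d (incSize s t)
  | l + 1, t, d =>
    let r := layOut (disorderedBlock s l) (incSize s t) (t + incSize s t) d
    r.1 ++ r.2

/-- The concatenation of the first `n` disordered blocks, the `s`-th one having parameter `s` and
level `s` and starting, in time and in doors, where the previous ones end. -/
def blockPrefix : ℕ → List ℕ
  | 0 => []
  | s + 1 => blockPrefix s ++ disorderedBlock s s (blockPrefix s).length (blockPrefix s).length

/-- The infinite concatenation of all the disordered blocks, a map from times to doors. (Every block
is non-empty, so the first `x + 1` blocks cover time `x`.) -/
def blockInjection (x : ℕ) : ℕ := (blockPrefix (x + 1)).getD x 0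

end Stochasticity

/-! `blockInjection` profits from opening doors out of order. In a block of positive level it first
visits the doors e_0 < e_1 < … of the increasing part, skipping the gaps between them, which it
visits later; an orderly contestant must pass each gap before it reaches the next e_i. The host
moves through the doors from left to right, placing cars behind the e_i. Suppose that every
contestant still unrestricted would open at least s doors of the gap after e_i if that gap were
empty. Then the gap is left empty, and the s fruitless openings pay for a car behind the next e_i.
If this happens at every gap, the increasing part is almost full, and it is so long that the
injection has found cars at nearly all times so far. Otherwise some contestant opens fewer than s
doors of a gap. These few doors can be avoided: cars behind the other doors of the gap are invisible
to it. The game moves into that gap, which is a block of one level less facing one unrestricted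
contestant less, and everything after the gap stays empty. At level 0 nobody is unrestricted and all
but at most s * s doors are filled. `layOut_solvable` is one level of this argument and
`solvable_disorderedBlock` the induction; block s has level s in order to face the first s
contestants.

The contestants are all partial computable rules. A suitable filling of a block exists against any
sequence of partial rules (`exists_good`), so the first one in an enumeration can be taken, and this
choice depends on finitely many values of the rules. With the rules replaced by their computations
bounded by k, the construction is computable and converges as k grows; the limit lemma then gives
`carSet_reducible`.

Adding up the blocks from S on, each rule with index below S finds there at most one car in S
openings (`mul_hits_le_opened`), which for all S gives density 0. Each block also provides a time at
which the injection has missed at most one car in s (`exists_time_miss_carSet`), which gives upper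
density 1. Functional contestants become rules through `skipPlay_of_consistent`. -/

namespace Stochasticity

/-! ### Misses and favourable times -/

open Classical in
/-- The length of the part of `l` outside `B`. -/
noncomputable def missCount (B : Set ℕ) (l : List ℕ) : ℕ :=
  (l.filter (fun x => decide (x ∉ B))).length

theorem missCount_le_length (B : Set ℕ) (l : List ℕ) : missCount B l ≤ l.length :=
  List.length_filter_le _ _

theorem missCount_append (B : Set ℕ) (l l' : List ℕ) :
    missCount B (l ++ l') = missCount B l + missCount B l' := by
  simp [missCount]

theorem missCount_mono {B B' : Set ℕ} (l : List ℕ) (h : ∀ x ∈ l, x ∈ B' → x ∈ B) :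
    missCount B l ≤ missCount B' l := by
  classical
  unfold missCount
  simp only [← List.countP_eq_length_filter]
  refine List.countP_mono_left fun x hx hB => ?_
  simp only [decide_eq_true_eq] at hB ⊢
  exact fun h' => hB (h x hx h')

theorem missCount_le_card {B : Set ℕ} {l : List ℕ} (hl : l.Nodup) {D : Finset ℕ}
    (h : ∀ x ∈ l, x ∉ D → x ∈ B) : missCount B l ≤ D.card := by
  classical
  unfold missCount
  rw [← List.toFinset_card_of_nodup (hl.filter _)]
  refine Finset.card_le_card fun x hx => ?_
  simp only [List.toFinset_filter, decide_eq_true_eq, Finset.mem_filter, List.mem_toFinset] at hx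
  by_contra hD
  exact hx.2 (h x hx.1 hD)

/-- At some time during the block `l` that starts at time `t`, a player going through the block has
found cars at all but a fraction of `1 / s` of the times, even if it found none before. -/
def Favourable (s t : ℕ) (l : List ℕ) (B : Set ℕ) : Prop :=
  ∃ n ≤ l.length, s * (t + missCount B (l.take n)) ≤ t + n

theorem Favourable.append {s t : ℕ} {l l' : List ℕ} {B B' : Set ℕ} (h : Favourable s t l B')
    (hB : B' ⊆ B) : Favourable s t (l ++ l') B := by
  obtain ⟨n, hn, h⟩ := h
  refine ⟨n, by simp; omega, le_trans (Nat.mul_le_mul_left _ ?_) h⟩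
  rw [List.take_append_of_le_length hn]
  exact Nat.add_le_add_left (missCount_mono _ fun x _ hx => hB hx) _

/-- `Favourable` already counts every time before the block as a miss, so whatever happens during
`l` can only help. -/
theorem Favourable.prepend {s t : ℕ} {l l' : List ℕ} {B B' : Set ℕ}
    (h : Favourable s (t + l.length) l' B') (hB : B' ⊆ B) : Favourable s t (l ++ l') B := by
  obtain ⟨n, hn, h⟩ := h
  refine ⟨l.length + n, by simp; omega, ?_⟩
  rw [List.take_length_add_append, missCount_append]
  refine le_trans (Nat.mul_le_mul_left _ ?_) (h.trans_eq (by ring))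
  have h1 := missCount_le_length B l
  have h2 := missCount_mono (l'.take n) (fun x _ hx => hB hx : ∀ x ∈ l'.take n, x ∈ B' → x ∈ B)
  omega

/-! ### Adaptive contestants and the doors they open -/

/-- An operator giving the set of the doors opened by a contestant when the cars are behind the
doors in a given set: whether a door is opened depends only on what was behind the smaller doors
that were opened. -/
def Adaptive (O : Set ℕ → Set ℕ) : Prop :=
  ∀ A B x, (∀ y < x, y ∈ O A → (y ∈ A ↔ y ∈ B)) → (x ∈ O A ↔ x ∈ O B)

/-- Cars behind unopened doors are never seen, hence do not change the play. This lets the host add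
cars without waking up a restricted contestant. -/
theorem Adaptive.union_eq {O : Set ℕ → Set ℕ} (hO : Adaptive O) {A E : Set ℕ}
    (h : ∀ x ∈ E, x ∉ O A) : O (A ∪ E) = O A := by
  ext x
  refine (hO A (A ∪ E) x fun y _ hy => ⟨Or.inl, ?_⟩).symm
  rintro (h' | h')
  · exact h'
  · exact absurd hy (h y h')

theorem Adaptive.mem_iff {O : Set ℕ → Set ℕ} (hO : Adaptive O) {A B : Set ℕ} {x b : ℕ}
    (h : ∀ y < b, (y ∈ A ↔ y ∈ B)) (hx : x ≤ b) : x ∈ O A ↔ x ∈ O B :=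
  hO A B x fun y hy _ => h y (by omega)

open Classical in
/-- The number of doors in `[a, b)` that are opened. -/
noncomputable def opened (O : Set ℕ → Set ℕ) (A : Set ℕ) (a b : ℕ) : ℕ :=
  ((Finset.Ico a b).filter (· ∈ O A)).card

open Classical in
/-- The number of doors in `[a, b)` that are opened and contain a car. -/
noncomputable def hits (O : Set ℕ → Set ℕ) (A : Set ℕ) (a b : ℕ) : ℕ :=
  ((Finset.Ico a b).filter (fun x => x ∈ O A ∧ x ∈ A)).card

section Counts

open scoped Classical

variable {O : Set ℕ → Set ℕ} {A B : Set ℕ} {a b c : ℕ}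

theorem card_filter_Ico_add (p : ℕ → Prop) [DecidablePred p] (hab : a ≤ b) (hbc : b ≤ c) :
    ((Finset.Ico a c).filter p).card =
      ((Finset.Ico a b).filter p).card + ((Finset.Ico b c).filter p).card := by
  rw [← Finset.Ico_union_Ico_eq_Ico hab hbc, Finset.filter_union, Finset.card_union_of_disjoint]
  exact Finset.disjoint_filter_filter (Finset.Ico_disjoint_Ico_consecutive a b c)

theorem opened_add (hab : a ≤ b) (hbc : b ≤ c) :
    opened O A a c = opened O A a b + opened O A b c :=
  card_filter_Ico_add _ hab hbc

theorem hits_add (hab : a ≤ b) (hbc : b ≤ c) : hits O A a c = hits O A a b + hits O A b c :=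
  card_filter_Ico_add _ hab hbc

theorem opened_mono {a' b' : ℕ} (ha : a' ≤ a) (hb : b ≤ b') : opened O A a b ≤ opened O A a' b' :=
  Finset.card_le_card (Finset.filter_subset_filter _ (Finset.Ico_subset_Ico ha hb))

theorem hits_le_opened : hits O A a b ≤ opened O A a b :=
  Finset.card_le_card fun x => by simp +contextual

theorem opened_congr (hO : Adaptive O) (h : ∀ y < b, (y ∈ A ↔ y ∈ B)) :
    opened O A a b = opened O B a b := by
  unfold opened
  congr 1
  refine Finset.filter_congr fun x hx => ?_
  exact hO.mem_iff h (Finset.mem_Ico.1 hx).2.le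

theorem hits_eq_zero (h : ∀ x, a ≤ x → x < b → x ∈ A → x ∉ O A) : hits O A a b = 0 := by
  unfold hits
  rw [Finset.card_eq_zero, Finset.filter_eq_empty_iff]
  rintro x hx ⟨h1, h2⟩
  exact h x (Finset.mem_Ico.1 hx).1 (Finset.mem_Ico.1 hx).2 h2 h1

theorem hits_eq_zero_of_le (h : b ≤ a) : hits O A a b = 0 :=
  hits_eq_zero fun x h1 h2 => by omega

end Counts

/-! ### Placing cars in one level of a block -/

/-- The statement to be proved for blocks of level `l`. Of the first `s` contestants those in `L` are
unrestricted, and the others open at most `s` doors of the block if there are no cars in it. Then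
cars can be placed favourably in the block so that at any time each contestant in `L` has found at
most one car every `s` doors in the block, and the others none. -/
def Solvable (s : ℕ) (O : ℕ → Set ℕ → Set ℕ) (l : ℕ) (sub : ℕ → ℕ → List ℕ) : Prop :=
  ∀ t d A (L : Finset ℕ), (∀ x ∈ A, x < d) → L.card ≤ l →
    (∀ j < s, j ∉ L → opened (O j) A d (d + (sub t d).length) ≤ s) →
    ∃ B : Set ℕ, (∀ x ∈ B, d ≤ x ∧ x < d + (sub t d).length) ∧
      (∀ j < s, j ∈ L → ∀ y ≤ d + (sub t d).length,
        s * hits (O j) (A ∪ B) d y ≤ opened (O j) (A ∪ B) d y) ∧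
      (∀ j < s, j ∉ L → ∀ x ∈ B, x ∉ O j A) ∧ Favourable s t (sub t d) B

theorem hits_le_of_subset_singleton {O : Set ℕ → Set ℕ} {A : Set ℕ} {e y : ℕ} {p : Prop}
    [Decidable p] (h : ∀ x, e ≤ x → x < y → x ∈ A → x = e ∧ ¬ p) :
    hits O A e y ≤ if p then 0 else 1 := by
  classical
  split_ifs with hp
  · exact (hits_eq_zero fun x h1 h2 h3 => absurd hp (h x h1 h2 h3).2).le
  · refine le_trans (Finset.card_le_card (t := {e}) fun x hx => ?_) (Finset.card_singleton e).le
    simp only [Finset.mem_filter, Finset.mem_Ico] at hx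
    exact Finset.mem_singleton.2 (h x hx.1.1 hx.1.2 hx.2.2).1

-- Induction on the number of remaining groups, each a door `e` followed by a gap. `D` collects
-- doors of the increasing part that are to stay empty, among them all those opened by restricted
-- contestants. The term `if e ∈ D then 0 else s` is a credit of s openings that pays for the car
-- behind `e`; a gap with s openings for everybody in `L` replenishes it for the next group. The
-- final disjunction records whether the walk reached the end or stopped in a gap.
open Classical in
theorem layOut_solvable {s l : ℕ} {O : ℕ → Set ℕ → Set ℕ} (hO : ∀ j, Adaptive (O j))
    {sub : ℕ → ℕ → List ℕ} (hsub : Solvable s O l sub) {L : Finset ℕ} (hL : L.card ≤ l + 1)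
    (D : Set ℕ) (k : ℕ) : ∀ t e A, (∀ x ∈ A, x < e) →
    (∀ j < s, j ∉ L →
      opened (O j) A e (e + (k + (layOut sub k t e).2.length)) ≤ s ∧
      ∀ x ∈ O j A, e ≤ x → x < e + (k + (layOut sub k t e).2.length) → x ∈ D) →
    ∃ B : Set ℕ, (∀ x ∈ B, e ≤ x ∧ x < e + (k + (layOut sub k t e).2.length)) ∧
      (∀ j < s, j ∈ L → ∀ y ≤ e + (k + (layOut sub k t e).2.length),
        s * hits (O j) (A ∪ B) e y ≤ opened (O j) (A ∪ B) e y + if e ∈ D then 0 else s) ∧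
      (∀ j < s, j ∉ L → ∀ x ∈ B, x ∉ O j A) ∧
      ((∀ x ∈ (layOut sub k t e).1, x ∉ D → x ∈ B) ∨ Favourable s t (layOut sub k t e).2 B) := by
  induction k with
  | zero =>
    intro t e A hA hdead
    refine ⟨∅, by simp, fun j _ _ y hy => ?_, by simp, Or.inl (by simp [layOut])⟩
    rw [hits_eq_zero_of_le (by simpa [layOut] using hy)]
    simp
  | succ k ih =>
    intro t e A hA hdead
    set b := sub t (e + 1) with hb
    set r := layOut sub k (t + b.length) (e + b.length + 1) with hr
    have hlay : layOut sub (k + 1) t e = (e :: r.1, b ++ r.2) := rfl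
    rw [hlay] at hdead ⊢
    simp only [List.length_append] at hdead ⊢
    -- The car behind the first door, or nothing if that door is in `D`.
    set E : Set ℕ := {x | x = e ∧ x ∉ D} with hE
    have hEe : ∀ x ∈ E, x = e ∧ e ∉ D := fun x hx => ⟨hx.1, hx.1 ▸ hx.2⟩
    have hXlt : ∀ x ∈ A ∪ E, x < e + 1 := by
      rintro x (hx | hx)
      · have := hA x hx; omega
      · have := (hEe x hx).1; omega
    have hEdead : ∀ j < s, j ∉ L → ∀ x ∈ E, x ∉ O j A := by
      intro j hj hjL x hx hxO
      obtain ⟨rfl, h2⟩ := hEe x hx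
      exact h2 ((hdead j hj hjL).2 x hxO le_rfl (by omega))
    have hXO : ∀ j < s, j ∉ L → O j (A ∪ E) = O j A := fun j hj hjL =>
      (hO j).union_eq (hEdead j hj hjL)
    have hopX : ∀ j < s, j ∉ L → ∀ a c, opened (O j) (A ∪ E) a c = opened (O j) A a c := by
      intro j hj hjL a c
      simp only [opened, hXO j hj hjL]
    have hcars : ∀ (B' : Set ℕ) (y : ℕ), (∀ x ∈ B', y ≤ x) → ∀ x, e ≤ x → x < y →
        x ∈ A ∪ E ∪ B' → x = e ∧ ¬ e ∈ D := by
      rintro B' y hB' x h1 h2 ((h3 | h3) | h3)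
      · have := hA x h3; omega
      · exact hEe x h3
      · have := hB' x h3; omega
    -- The openings are counted with the gap empty: if some contestant of `L` opens fewer than s
    -- doors, it becomes restricted and the gap is filled at level `l`.
    by_cases hcase : ∃ j < s, j ∈ L ∧ opened (O j) (A ∪ E) (e + 1) (e + 1 + b.length) < s
    · obtain ⟨j₀, hj₀, hj₀L, hj₀o⟩ := hcase
      obtain ⟨B', hB'1, hB'2, hB'3, hB'4⟩ := hsub t (e + 1) (A ∪ E) (L.erase j₀) hXlt
        (by rw [Finset.card_erase_of_mem hj₀L]; omega)
        (by
          intro j hj hjL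
          by_cases hjj : j = j₀
          · subst hjj; exact hj₀o.le
          · have hjL' : j ∉ L := fun h => hjL (Finset.mem_erase.2 ⟨hjj, h⟩)
            rw [hopX j hj hjL']
            exact le_trans (opened_mono (by omega) (by rw [← hb]; omega)) (hdead j hj hjL').1)
      rw [← hb] at hB'1 hB'2 hB'4
      refine ⟨E ∪ B', ?_, ?_, ?_, Or.inr ?_⟩
      · rintro x (hx | hx)
        · have := (hEe x hx).1; omega
        · have := hB'1 x hx; omega
      · intro j hj hjL y hy
        rw [← Set.union_assoc]
        have key : ∀ y ≤ e + 1 + b.length, s * hits (O j) (A ∪ E ∪ B') (e + 1) y ≤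
            opened (O j) (A ∪ E ∪ B') (e + 1) y := by
          intro y hy
          by_cases hjj : j = j₀
          · subst hjj
            have hd := hB'3 j hj (Finset.notMem_erase _ _)
            rw [hits_eq_zero]
            · simp
            · rintro x h1 h2 (h3 | h3)
              · have := hXlt x h3; omega
              · rw [(hO j).union_eq hd]; exact hd x h3
          · exact hB'2 j hj (Finset.mem_erase.2 ⟨hjj, hjL⟩) y hy
        -- Past the gap there are no more cars, so the bound only improves.
        have key2 : s * hits (O j) (A ∪ E ∪ B') (e + 1) y ≤
            opened (O j) (A ∪ E ∪ B') (e + 1) y := by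
          rcases le_total y (e + 1 + b.length) with h | h
          · exact key y h
          · rw [hits_add (b := e + 1 + b.length) (by omega) h,
              opened_add (b := e + 1 + b.length) (by omega) h,
              hits_eq_zero (a := e + 1 + b.length)]
            · have := key _ le_rfl
              simp only [add_zero]; omega
            · rintro x h1 h2 (h3 | h3)
              · have := hXlt x h3; omega
              · have := hB'1 x h3; omega
        rcases Nat.lt_or_ge e y with hey | hey
        · rw [hits_add (b := e + 1) (by omega) hey, opened_add (b := e + 1) (by omega) hey]
          have h1 := hits_le_of_subset_singleton (O := O j)
            (hcars B' (e + 1) fun x hx => (hB'1 x hx).1)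
          have h2 := Nat.mul_le_mul_left s h1
          rw [Nat.mul_add]
          split_ifs at h2 ⊢ <;> omega
        · rw [hits_eq_zero_of_le hey]; simp
      · rintro j hj hjL x (hx | hx)
        · exact hEdead j hj hjL x hx
        · rw [← hXO j hj hjL]
          exact hB'3 j hj (fun h => hjL (Finset.mem_of_mem_erase h)) x hx
      · exact hB'4.append Set.subset_union_right
    · push Not at hcase
      obtain ⟨B', hB'1, hB'2, hB'3, hB'4⟩ := ih (t + b.length) (e + b.length + 1) (A ∪ E)
        (fun x hx => by have := hXlt x hx; omega)
        (by
          intro j hj hjL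
          rw [hopX j hj hjL, hXO j hj hjL, ← hr]
          obtain ⟨h1, h2⟩ := hdead j hj hjL
          exact ⟨le_trans (opened_mono (by omega) (by omega)) h1,
            fun x hx h3 h4 => h2 x hx (by omega) (by omega)⟩)
      rw [← hr] at hB'1 hB'2 hB'4
      have hlow : ∀ j < s, j ∈ L → ∀ y ≤ e + b.length + 1, s * hits (O j) (A ∪ E ∪ B') e y ≤
          if e ∈ D then 0 else s := by
        intro j _ _ y hy
        have h1 := hits_le_of_subset_singleton (O := O j)
          (hcars B' y fun x hx => by have := hB'1 x hx; omega)
        have h2 := Nat.mul_le_mul_left s h1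
        split_ifs at h2 ⊢ <;> omega
      refine ⟨E ∪ B', ?_, ?_, ?_, ?_⟩
      · rintro x (hx | hx)
        · have := (hEe x hx).1; omega
        · have := hB'1 x hx; omega
      · intro j hj hjL y hy
        rw [← Set.union_assoc]
        rcases le_total y (e + b.length + 1) with h | h
        · exact le_trans (hlow j hj hjL y h) (Nat.le_add_left _ _)
        · rw [hits_add (b := e + b.length + 1) (by omega) h,
            opened_add (b := e + b.length + 1) (by omega) h, Nat.mul_add]
          have h1 := hlow j hj hjL _ le_rfl
          have h2 := hB'2 j hj hjL y (by omega)
          have h3 := hcase j hj hjL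
          -- All further cars lie beyond the gap, so they do not affect what is opened in it.
          have h4 : opened (O j) (A ∪ E) (e + 1) (e + 1 + b.length) ≤
              opened (O j) (A ∪ E ∪ B') e (e + b.length + 1) := by
            rw [opened_congr (hO j) (A := A ∪ E ∪ B') (B := A ∪ E)]
            · exact opened_mono (by omega) (by omega)
            · intro y hy
              refine ⟨?_, Or.inl⟩
              rintro (h | h)
              · exact h
              · have := hB'1 y h; omega
          have h5 : (if e + b.length + 1 ∈ D then 0 else s) ≤ s := by split_ifs <;> omega
          omega
      · rintro j hj hjL x (hx | hx)
        · exact hEdead j hj hjL x hx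
        · rw [← hXO j hj hjL]
          exact hB'3 j hj hjL x hx
      · refine hB'4.imp (fun h x hx hxD => ?_) (fun h => h.prepend Set.subset_union_right)
        rcases List.mem_cons.1 hx with rfl | hx
        · exact Or.inl ⟨rfl, hxD⟩
        · exact Or.inr (h x hx hxD)

/-! ### Blocks permute intervals; injectivity -/

theorem layOut_fst_length (sub : ℕ → ℕ → List ℕ) (k : ℕ) :
    ∀ t e, (layOut sub k t e).1.length = k := by
  induction k with
  | zero => intro t e; rfl
  | succ k ih => intro t e; simp [layOut, ih]

/-- In order of doors, each group is one door followed by an interval, and consecutive groups are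
adjacent; only the times are rearranged. -/
theorem layOut_perm {sub : ℕ → ℕ → List ℕ}
    (hsub : ∀ t d, (sub t d).Perm (List.range' d (sub t d).length)) (k : ℕ) :
    ∀ t e, ((layOut sub k t e).1 ++ (layOut sub k t e).2).Perm
      (List.range' e (k + (layOut sub k t e).2.length)) := by
  induction k with
  | zero => intro t e; simp [layOut]
  | succ k ih =>
    intro t e
    simp only [layOut, List.length_append]
    set b := sub t (e + 1) with hb
    set r := layOut sub k (t + b.length) (e + b.length + 1) with hr
    have h1 : (e :: r.1 ++ (b ++ r.2)).Perm (e :: (b ++ (r.1 ++ r.2))) := by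
      rw [List.cons_append, List.perm_cons, ← List.append_assoc, ← List.append_assoc]
      exact List.perm_append_comm.append_right _
    refine h1.trans ?_
    have h2 : List.range' e (k + 1 + (b.length + r.2.length)) =
        e :: (List.range' (e + 1) b.length ++
          List.range' (e + b.length + 1) (k + r.2.length)) := by
      rw [show k + 1 + (b.length + r.2.length) = (b.length + (k + r.2.length)) + 1 by ring,
        List.range'_succ, show e + b.length + 1 = e + 1 + b.length by ring, List.range'_append_1]
    rw [h2, List.perm_cons]
    exact (hsub t (e + 1)).append (ih _ _)

theorem disorderedBlock_perm (s l : ℕ) : ∀ t d,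
    (disorderedBlock s l t d).Perm (List.range' d (disorderedBlock s l t d).length) := by
  induction l with
  | zero => intro t d; simp [disorderedBlock]
  | succ l ih =>
    intro t d
    simp only [disorderedBlock, List.length_append, layOut_fst_length]
    exact layOut_perm ih _ _ _

theorem disorderedBlock_length_pos (s l t d : ℕ) : 0 < (disorderedBlock s l t d).length := by
  cases l with
  | zero => simp [disorderedBlock, incSize]
  | succ l => simp [disorderedBlock, layOut_fst_length, incSize]

theorem blockPrefix_perm (n : ℕ) :
    (blockPrefix n).Perm (List.range (blockPrefix n).length) := by
  induction n with
  | zero => simp [blockPrefix]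
  | succ n ih =>
    simp only [blockPrefix, List.length_append]
    rw [List.range_add]
    refine ih.append ?_
    rw [← List.range'_eq_map_range]
    exact disorderedBlock_perm _ _ _ _

theorem le_blockPrefix_length (n : ℕ) : n ≤ (blockPrefix n).length := by
  induction n with
  | zero => simp
  | succ n ih =>
    have := disorderedBlock_length_pos n n (blockPrefix n).length (blockPrefix n).length
    simp only [blockPrefix, List.length_append]
    omega

theorem blockPrefix_prefix {m n : ℕ} (h : m ≤ n) : blockPrefix m <+: blockPrefix n := by
  induction n, h using Nat.le_induction with
  | base => exact List.prefix_rfl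
  | succ n _ ih => exact ih.trans (List.prefix_append _ _)

theorem blockInjection_eq {n x : ℕ} (h : x < (blockPrefix n).length) :
    blockInjection x = (blockPrefix n).getD x 0 := by
  have key : ∀ {m n}, m ≤ n → x < (blockPrefix m).length →
      (blockPrefix m).getD x 0 = (blockPrefix n).getD x 0 := by
    intro m n hmn hx
    obtain ⟨l, hl⟩ := blockPrefix_prefix hmn
    rw [← hl, List.getD_append _ _ _ _ hx]
  have hx : x < (blockPrefix (x + 1)).length := le_blockPrefix_length (x + 1)
  rcases le_total (x + 1) n with h' | h'
  · exact key h' hx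
  · exact (key h' h).symm

theorem blockPrefix_nodup (n : ℕ) : (blockPrefix n).Nodup :=
  (blockPrefix_perm n).nodup_iff.2 List.nodup_range

theorem blockInjection_injective : Function.Injective blockInjection := by
  intro x y h
  have hl := le_blockPrefix_length (x + y + 1)
  rw [blockInjection_eq (n := x + y + 1) (by omega), blockInjection_eq (n := x + y + 1) (by omega),
    List.getD_eq_getElem _ _ (by omega), List.getD_eq_getElem _ _ (by omega)] at h
  exact (List.Nodup.getElem_inj_iff (blockPrefix_nodup _)).1 h

/-! ### Placing cars in a whole block, by induction on the level -/

-- Level 0 has only restricted contestants, and the whole block can be filled except for their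
-- doors. At a higher level, either `layOut_solvable` fills the increasing part up to the set `D`,
-- or it finds a favourable time in a sub-block.
open Classical in
theorem solvable_disorderedBlock {s : ℕ} (hs : 2 ≤ s) {O : ℕ → Set ℕ → Set ℕ}
    (hO : ∀ j, Adaptive (O j)) (l : ℕ) : Solvable s O l (disorderedBlock s l) := by
  -- At most s contestants are restricted, with at most s doors each; the summand 1 is for the first
  -- door of the block.
  have hs3 : 1 + s * s ≤ s ^ 3 := by
    nlinarith [Nat.mul_le_mul hs hs, Nat.mul_le_mul hs (le_refl (s * s))]
  have hdeadcard : ∀ (L : Finset ℕ) (A : Set ℕ) (a b : ℕ),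
      (∀ j < s, j ∉ L → opened (O j) A a b ≤ s) →
      (((Finset.range s).filter (· ∉ L)).biUnion
        fun j => (Finset.Ico a b).filter (· ∈ O j A)).card ≤ s * s := by
    intro L A a b h
    refine le_trans (Finset.card_biUnion_le_card_mul _ _ s fun j hj => ?_)
      (Nat.mul_le_mul_right _ (le_trans (Finset.card_filter_le _ _) (Finset.card_range s).le))
    simp only [Finset.mem_filter, Finset.mem_range] at hj
    exact h j hj.1 hj.2
  induction l with
  | zero =>
    intro t d A L hA hL hdead
    have hL0 : L = ∅ := Finset.card_eq_zero.1 (Nat.le_zero.1 hL)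
    subst hL0
    simp only [disorderedBlock, List.length_range'] at hdead ⊢
    set m := incSize s t with hm
    set D := ((Finset.range s).filter (· ∉ (∅ : Finset ℕ))).biUnion
        fun j => (Finset.Ico d (d + m)).filter (· ∈ O j A) with hD
    have hDcard : D.card ≤ s * s := hdeadcard ∅ A d (d + m) hdead
    refine ⟨{x | d ≤ x ∧ x < d + m ∧ x ∉ D}, fun x hx => ⟨hx.1, hx.2.1⟩, by simp, ?_, m, by simp, ?_⟩
    · intro j hj _ x hx hxO
      refine hx.2.2 (Finset.mem_biUnion.2 ⟨j, by simpa using hj, ?_⟩)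
      simp only [Finset.mem_filter, Finset.mem_Ico]
      exact ⟨⟨hx.1, hx.2.1⟩, hxO⟩
    · rw [List.take_of_length_le (by simp)]
      have h1 : missCount {x | d ≤ x ∧ x < d + m ∧ x ∉ D} (List.range' d m) ≤ D.card :=
        missCount_le_card List.nodup_range' fun x hx hxD => by
          rw [List.mem_range'_1] at hx
          exact ⟨hx.1, hx.2, hxD⟩
      refine le_trans (Nat.mul_le_mul_left s (Nat.add_le_add_left
        (h1.trans (hDcard.trans (by omega : s * s ≤ s ^ 3))) t)) ?_
      rw [hm, incSize, Nat.mul_comm]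
      omega
  | succ l ih =>
    intro t d A L hA hL hdead
    simp only [disorderedBlock, List.length_append, layOut_fst_length] at hdead ⊢
    set m := incSize s t with hm
    set r := layOut (disorderedBlock s l) m (t + m) d with hr
    -- At the start nothing has been opened to pay for a car behind `d`. Putting `d` into `D` keeps
    -- this door empty and makes the initial credit 0.
    set D := insert d (((Finset.range s).filter (· ∉ L)).biUnion
        fun j => (Finset.Ico d (d + (m + r.2.length))).filter (· ∈ O j A)) with hD
    have hDcard : D.card ≤ s ^ 3 :=
      le_trans (Finset.card_insert_le _ _) (by have := hdeadcard L A d _ hdead; omega)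
    obtain ⟨B, hB1, hB2, hB3, hB4⟩ := layOut_solvable hO ih hL (D : Set ℕ) m (t + m) d A hA
      (by
        intro j hj hjL
        refine ⟨hdead j hj hjL, fun x hx h1 h2 => ?_⟩
        refine Finset.mem_coe.2 (Finset.mem_insert_of_mem (Finset.mem_biUnion.2 ⟨j, ?_, ?_⟩))
        · simpa using ⟨hj, hjL⟩
        · simp only [Finset.mem_filter, Finset.mem_Ico]
          exact ⟨⟨h1, h2⟩, hx⟩)
    rw [← hr] at hB1 hB2 hB4
    have hlen : r.1.length = m := layOut_fst_length _ _ _ _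
    refine ⟨B, hB1, ?_, hB3, ?_⟩
    · simpa [hD] using hB2
    · rcases hB4 with h | h
      · refine ⟨m, by simp [hlen], ?_⟩
        rw [List.take_append_of_le_length hlen.ge, List.take_of_length_le hlen.le]
        have hnd : r.1.Nodup := by
          have := ((layOut_perm (disorderedBlock_perm s l) m (t + m) d).nodup_iff).2
            List.nodup_range'
          exact (List.nodup_append.1 this).1
        have h1 : missCount B r.1 ≤ D.card :=
          missCount_le_card hnd fun x hx hxD => h x hx (by simpa using hxD)
        -- Even if all `t` earlier times are wasted, there are at most `t + s ^ 3` misses by the end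
        -- of the increasing part; `incSize` is chosen to exceed s times that.
        refine le_trans (Nat.mul_le_mul_left s (Nat.add_le_add_left (h1.trans hDcard) t)) ?_
        rw [hm, incSize, Nat.mul_comm]
        omega
      · exact Favourable.prepend (by rwa [hlen]) subset_rfl

/-! ### Computability of the injection -/

open Encodable Denumerable Nat.Partrec

/-- One step of the computation of `layOut`, on the current time, the current door and the lists
built so far. -/
def layStep (e : ℕ) (b : List ℕ) (p : ℕ × List ℕ × List ℕ) : ℕ × ℕ × List ℕ × List ℕ :=
  (p.1 + b.length, e + b.length + 1, p.2.1 ++ [e], p.2.2 ++ b)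

/-- The computation of `layOut` with sub-blocks computed by a code. -/
def layRun (c : Code) (s l k t e : ℕ) : Part (ℕ × ℕ × List ℕ × List ℕ) :=
  k.rec (Part.some (t, e, [], [])) fun _ IH => IH.bind fun p =>
    (c.eval (encode (s, l, p.1, p.2.1 + 1))).map fun v => layStep p.2.1 (ofNat (List ℕ) v) (p.1, p.2.2)

/-- The computation of a disordered block with sub-blocks computed by a code. -/
def blockRun (c : Code) (q : ℕ × ℕ × ℕ × ℕ) : Part (List ℕ) :=
  Nat.casesOn q.2.1 (Part.some (List.range' q.2.2.2 (incSize q.1 q.2.2.1))) fun l =>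
    (layRun c q.1 l (incSize q.1 q.2.2.1) (q.2.2.1 + incSize q.1 q.2.2.1) q.2.2.2).map
      fun p => p.2.2.1 ++ p.2.2.2

/-- The definition peels off the first group, whereas a loop appends the last one; this is the loop
form needed in `layRun_eq`. -/
theorem layOut_succ' (sub : ℕ → ℕ → List ℕ) (k : ℕ) : ∀ t e,
    layOut sub (k + 1) t e =
      ((layOut sub k t e).1 ++ [e + (layOut sub k t e).2.length + k],
        (layOut sub k t e).2 ++ sub (t + (layOut sub k t e).2.length)
          (e + (layOut sub k t e).2.length + k + 1)) := by
  induction k with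
  | zero => intro t e; simp [layOut]
  | succ k ih =>
    intro t e
    conv_lhs => rw [layOut, ih]
    simp only [layOut, List.cons_append, List.append_assoc, List.length_append]
    refine Prod.ext ?_ ?_
    · simp only [List.cons.injEq, true_and, and_true, List.append_cancel_left_eq]
      ring
    · simp only [List.append_cancel_left_eq]
      congr 1 <;> ring

theorem layRun_eq {c : Code} {s l : ℕ} {sub : ℕ → ℕ → List ℕ}
    (hc : ∀ t d, c.eval (encode (s, l, t, d)) = Part.some (encode (sub t d))) (k t e : ℕ) :
    layRun c s l k t e = Part.some (t + (layOut sub k t e).2.length,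
      e + (layOut sub k t e).2.length + k, layOut sub k t e) := by
  induction k with
  | zero => simp [layRun, layOut]
  | succ k ih =>
    have : layRun c s l (k + 1) t e = (layRun c s l k t e).bind fun p =>
      (c.eval (encode (s, l, p.1, p.2.1 + 1))).map
        fun v => layStep p.2.1 (ofNat (List ℕ) v) (p.1, p.2.2) := rfl
    rw [this, ih, layOut_succ']
    simp only [Part.bind_some, hc, Part.map_some, layStep, List.length_append, ofNat_encode]
    congr 2
    · ring
    · congr 1; ring

theorem primrec_incSize : Primrec₂ incSize :=
  (Primrec.succ.comp (Primrec.nat_mul.comp (Primrec.nat_add.comp Primrec.snd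
    (Primrec.nat_mul.comp (Primrec.nat_mul.comp Primrec.fst Primrec.fst) Primrec.fst))
    Primrec.fst)).of_eq fun p => by simp only [incSize, Nat.succ_eq_add_one]; ring

theorem primrec_range' : Primrec₂ fun d m : ℕ => List.range' d m :=
  (Primrec.list_map (Primrec.list_range.comp Primrec.snd)
    (Primrec.nat_add.comp (Primrec.fst.comp Primrec.fst) Primrec.snd).to₂).of_eq fun p => by
      simp only [List.range'_eq_map_range]

theorem primrec_layStep :
    Primrec fun p : (ℕ × List ℕ) × (ℕ × List ℕ × List ℕ) => layStep p.1.1 p.1.2 p.2 := by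
  have he := Primrec.fst.comp (Primrec.fst (α := ℕ × List ℕ) (β := ℕ × List ℕ × List ℕ))
  have hb := Primrec.snd.comp (Primrec.fst (α := ℕ × List ℕ) (β := ℕ × List ℕ × List ℕ))
  have hp := Primrec.snd (α := ℕ × List ℕ) (β := ℕ × List ℕ × List ℕ)
  have hl := Primrec.list_length.comp hb
  exact ((Primrec.nat_add.comp (Primrec.fst.comp hp) hl).pair
    ((Primrec.succ.comp (Primrec.nat_add.comp he hl)).pair
      ((Primrec.list_concat.comp (Primrec.fst.comp (Primrec.snd.comp hp)) he).pair
        (Primrec.list_append.comp (Primrec.snd.comp (Primrec.snd.comp hp)) hb))))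

theorem partrec_layRun : Partrec fun q : (Code × ℕ × ℕ) × (ℕ × ℕ × ℕ) =>
    layRun q.1.1 q.1.2.1 q.1.2.2 q.2.1 q.2.2.1 q.2.2.2 := by
  have hg : Computable fun q : (Code × ℕ × ℕ) × (ℕ × ℕ × ℕ) =>
      (q.2.2.1, q.2.2.2, ([] : List ℕ), ([] : List ℕ)) :=
    ((Primrec.fst.comp (Primrec.snd.comp Primrec.snd)).pair
      ((Primrec.snd.comp (Primrec.snd.comp Primrec.snd)).pair (Primrec.const _))).to_comp
  have hh : Partrec₂ fun (q : (Code × ℕ × ℕ) × (ℕ × ℕ × ℕ)) (y : ℕ × ℕ × ℕ × List ℕ × List ℕ) =>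
      (q.1.1.eval (encode (q.1.2.1, q.1.2.2, y.2.1, y.2.2.1 + 1))).map
        fun v => layStep y.2.2.1 (ofNat (List ℕ) v) (y.2.1, y.2.2.2) := by
    have hq := Primrec.fst (α := (Code × ℕ × ℕ) × (ℕ × ℕ × ℕ)) (β := ℕ × ℕ × ℕ × List ℕ × List ℕ)
    have hy := Primrec.snd.comp
      (Primrec.snd (α := (Code × ℕ × ℕ) × (ℕ × ℕ × ℕ)) (β := ℕ × ℕ × ℕ × List ℕ × List ℕ))
    have hs := Primrec.snd.comp (Primrec.fst.comp hq)
    have h1 : Computable fun p : ((Code × ℕ × ℕ) × (ℕ × ℕ × ℕ)) × (ℕ × ℕ × ℕ × List ℕ × List ℕ) =>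
        encode (p.1.1.2.1, p.1.1.2.2, p.2.2.1, p.2.2.2.1 + 1) :=
      (Primrec.encode.comp ((Primrec.fst.comp hs).pair ((Primrec.snd.comp hs).pair
        ((Primrec.fst.comp hy).pair
          (Primrec.succ.comp (Primrec.fst.comp (Primrec.snd.comp hy))))))).to_comp
    have h2 : Partrec fun p : ((Code × ℕ × ℕ) × (ℕ × ℕ × ℕ)) × (ℕ × ℕ × ℕ × List ℕ × List ℕ) =>
        p.1.1.1.eval (encode (p.1.1.2.1, p.1.1.2.2, p.2.2.1, p.2.2.2.1 + 1)) :=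
      Code.eval_part.comp (Primrec.fst.comp (Primrec.fst.comp hq)).to_comp h1
    have hy' := hy.comp (Primrec.fst (β := ℕ))
    have h3 : Computable₂ fun
        (p : ((Code × ℕ × ℕ) × (ℕ × ℕ × ℕ)) × (ℕ × ℕ × ℕ × List ℕ × List ℕ)) (v : ℕ) =>
        layStep p.2.2.2.1 (ofNat (List ℕ) v) (p.2.2.1, p.2.2.2.2) :=
      (primrec_layStep.comp (((Primrec.fst.comp (Primrec.snd.comp hy')).pair
        ((Primrec.ofNat (List ℕ)).comp Primrec.snd)).pair
          ((Primrec.fst.comp hy').pair (Primrec.snd.comp (Primrec.snd.comp hy'))))).to_comp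
    exact h2.map h3
  have hk : Computable fun q : (Code × ℕ × ℕ) × (ℕ × ℕ × ℕ) => q.2.1 :=
    (Primrec.fst.comp Primrec.snd).to_comp
  exact (Partrec.nat_rec hk hg.partrec hh).of_eq fun q => rfl

theorem partrec_blockRun : Partrec₂ blockRun := by
  have hq := Primrec.snd (α := Code) (β := ℕ × ℕ × ℕ × ℕ)
  have hs := Primrec.fst.comp hq
  have hl := Primrec.fst.comp (Primrec.snd.comp hq)
  have ht := Primrec.fst.comp (Primrec.snd.comp (Primrec.snd.comp hq))
  have hd := Primrec.snd.comp (Primrec.snd.comp (Primrec.snd.comp hq))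
  have hm := primrec_incSize.comp hs ht
  have hf := Primrec.fst (α := Code × ℕ × ℕ × ℕ × ℕ) (β := ℕ)
  have h1 : Computable fun q : (Code × ℕ × ℕ × ℕ × ℕ) × ℕ =>
      (((q.1.1, q.1.2.1, q.2), (incSize q.1.2.1 q.1.2.2.2.1,
        q.1.2.2.2.1 + incSize q.1.2.1 q.1.2.2.2.1, q.1.2.2.2.2)) :
          (Code × ℕ × ℕ) × (ℕ × ℕ × ℕ)) :=
    (((Primrec.fst.comp hf).pair ((hs.comp hf).pair Primrec.snd)).pair
      ((hm.comp hf).pair ((Primrec.nat_add.comp (ht.comp hf) (hm.comp hf)).pair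
        (hd.comp hf)))).to_comp
  have h2 : Computable₂ fun (_ : (Code × ℕ × ℕ × ℕ × ℕ) × ℕ) (p : ℕ × ℕ × List ℕ × List ℕ) =>
      p.2.2.1 ++ p.2.2.2 := by
    have := Primrec.snd (α := (Code × ℕ × ℕ × ℕ × ℕ) × ℕ) (β := ℕ × ℕ × List ℕ × List ℕ)
    exact (Primrec.list_append.comp (Primrec.fst.comp (Primrec.snd.comp (Primrec.snd.comp this)))
      (Primrec.snd.comp (Primrec.snd.comp (Primrec.snd.comp this)))).to_comp
  exact Partrec.nat_casesOn_right hl.to_comp (primrec_range'.comp hd hm).to_comp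
    ((partrec_layRun.comp h1).map h2)

/-- The recursion on the level passes a function of `t` and `d` to `layOut`. The recursion theorem
replaces that function by a code that calls itself. -/
theorem computable_disorderedBlock :
    Computable fun q : ℕ × ℕ × ℕ × ℕ => disorderedBlock q.1 q.2.1 q.2.2.1 q.2.2.2 := by
  have h1 : Partrec₂ fun (c : Code) (n : ℕ) =>
      (blockRun c (ofNat (ℕ × ℕ × ℕ × ℕ) n)).map encode :=
    (partrec_blockRun.comp Computable.fst ((Computable.ofNat _).comp Computable.snd)).map
      (Computable.encode.comp Computable.snd)
  obtain ⟨c, hc⟩ := Code.fixed_point₂ h1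
  have key : ∀ s l t d, blockRun c (s, l, t, d) = Part.some (disorderedBlock s l t d) := by
    intro s l
    -- A self-referential code could diverge; induction on the level shows that it halts with the
    -- right value.
    induction l with
    | zero => intro t d; rfl
    | succ l ih =>
      intro t d
      have : blockRun c (s, l + 1, t, d) =
        (layRun c s l (incSize s t) (t + incSize s t) d).map fun p => p.2.2.1 ++ p.2.2.2 := rfl
      rw [this, layRun_eq (sub := disorderedBlock s l) fun t d => by
        simp only [hc, ofNat_encode, ih, Part.map_some]]
      simp [disorderedBlock]
  have h2 : Partrec fun q : ℕ × ℕ × ℕ × ℕ => blockRun c q :=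
    partrec_blockRun.comp (Computable.const c) Computable.id
  exact h2.of_eq fun q => key q.1 q.2.1 q.2.2.1 q.2.2.2

theorem computable_blockPrefix : Computable blockPrefix := by
  have hy := Primrec.snd (α := ℕ) (β := ℕ × List ℕ)
  have hl := Primrec.list_length.comp (Primrec.snd.comp hy)
  have h1 : Computable₂ fun (_ : ℕ) (p : ℕ × List ℕ) =>
      p.2 ++ disorderedBlock p.1 p.1 p.2.length p.2.length :=
    Computable.list_append.comp (Primrec.snd.comp hy).to_comp
      (computable_disorderedBlock.comp ((Primrec.fst.comp hy).pair
        ((Primrec.fst.comp hy).pair (hl.pair hl))).to_comp)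
  refine (Computable.nat_rec Computable.id (Computable.const []) h1).of_eq fun n => ?_
  simp only [id]
  induction n with
  | zero => rfl
  | succ n ih => rw [blockPrefix, ← ih]

theorem computable_blockInjection : Computable blockInjection :=
  (Primrec.list_getD 0).to_comp.comp (computable_blockPrefix.comp Computable.succ) Computable.id

/-! ### The limit lemma -/

/-- The limit lemma: the limit of a computable sequence of approximations is computable in the
halting problem. -/
theorem setTuringReducible_haltingSet_of_limit {a : ℕ → ℕ → Bool} (ha : Computable₂ a) {A : Set ℕ}
    (hA : ∀ x, ∃ K, ∀ k ≥ K, (a x k = true ↔ x ∈ A)) : SetTuringReducible A haltingSet := by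
  classical
  have hu : Computable fun p : (ℕ × ℕ) × ℕ => p.1.1.unpair :=
    Computable.unpair.comp (Computable.fst.comp Computable.fst)
  -- The program searches for a change of the approximation at `x` after stage `k`. It ignores its
  -- last input, so that its halting on its own index already answers the question.
  have hp : Partrec₂ fun (q : ℕ × ℕ) (t : ℕ) =>
      (Part.some (a q.1.unpair.1 (q.1.unpair.2 + t) != a q.1.unpair.1 q.1.unpair.2) : Part Bool) :=
    ((Primrec.dom_bool₂ (· != ·)).to_comp.comp
      (ha.comp (Computable.fst.comp hu) (Primrec.nat_add.to_comp.comp (Computable.snd.comp hu)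
        Computable.snd)) (ha.comp (Computable.fst.comp hu) (Computable.snd.comp hu))).partrec
  have hr := Partrec.rfind hp
  obtain ⟨c, hc⟩ := Code.exists_code.1 (Partrec.nat_iff.1 (hr.comp Computable.unpair))
  have hdom : ∀ x k, encode (c.curry (Nat.pair x k)) ∈ haltingSet ↔ ∃ t, a x (k + t) ≠ a x k := by
    intro x k
    simp only [haltingSet, Set.mem_ofPred_eq, ofNat_encode, Code.eval_curry, hc, Nat.unpair_pair]
    exact Nat.rfind_dom.trans (by simp)
  have h1 : Nat.RecursiveIn {charFun haltingSet} fun n =>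
      (Part.some (encode (c.curry n)) : Part ℕ) :=
    Nat.Partrec.recursiveIn (Partrec.nat_iff.1
      (Primrec.encode.comp (Code.primrec₂_curry.comp (Primrec.const c) Primrec.id)).to_comp)
  have h1' : Nat.RecursiveIn {charFun haltingSet} fun n =>
      (Part.some (if encode (c.curry n) ∈ haltingSet then 1 else 0) : Part ℕ) :=
    (Nat.RecursiveIn.comp (Nat.RecursiveIn.oracle (O := {charFun haltingSet}) _ rfl) h1).of_eq
      fun n => Part.bind_some _ _
  have h2 := Nat.RecursiveIn.rfind h1'
  have h3 : Nat.RecursiveIn {charFun haltingSet} fun n => (Part.some n : Part ℕ) :=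
    Nat.Partrec.recursiveIn Nat.Partrec.some
  have h4 : Computable fun n : ℕ => cond (a n.unpair.1 n.unpair.2) 1 0 :=
    Computable.cond (ha.comp (Computable.fst.comp Computable.unpair)
      (Computable.snd.comp Computable.unpair)) (Computable.const 1) (Computable.const 0)
  have h5 := Nat.RecursiveIn.comp
    (Nat.Partrec.recursiveIn (O := {charFun haltingSet}) (Partrec.nat_iff.1 h4)) (h3.pair h2)
  refine RecursiveIn.iff_nat.2 (h5.of_eq fun x => ?_)
  obtain ⟨K, hK⟩ := hA x
  -- The oracle search looks for the first stage after which nothing changes; the value there is the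
  -- limit.
  have hfind : ∃ k, encode (c.curry (Nat.pair x k)) ∉ haltingSet := by
    refine ⟨K, ?_⟩
    rw [hdom]
    push Not
    intro t
    rw [Bool.eq_iff_iff, hK _ (by omega), hK _ le_rfl]
  have hval : Nat.rfind (fun k => (fun m => decide (m = 0)) <$>
      (Part.some (if encode (c.curry (Nat.pair x k)) ∈ haltingSet then 1 else 0) : Part ℕ)) =
      Part.some (Nat.find hfind) := by
    refine Part.eq_some_iff.2 (Nat.mem_rfind.2 ⟨?_, fun {m} hm => ?_⟩)
    · simp [Nat.find_spec hfind]
    · simp [not_not.1 (Nat.find_min hfind hm)]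
  have hlim : a x (Nat.find hfind) = true ↔ x ∈ A := by
    have := Nat.find_spec hfind
    rw [hdom] at this
    push Not at this
    rw [← this K, hK _ (by omega)]
  simp only [hval]
  simp only [Part.map_eq_map, Part.map_some, Seq.seq, Part.bind_some]
  refine (Part.bind_some _ _).trans ?_
  by_cases hx : x ∈ A
  · simp [hx, hlim.2 hx, charFun]
  · simp [hx, Bool.eq_false_iff.2 (mt hlim.1 hx), charFun]

/-! ### Playing partial rules against finite lists of doors -/

/-- The state of the cars behind the first doors is coded by the list of their truth values, the
last door coming first. `carAt P x` tells whether there is a car behind door `x`. -/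
def carAt (P : List Bool) (x : ℕ) : Bool := P.reverse.getD x false

theorem carAt_cons (b : Bool) (P : List Bool) (x : ℕ) :
    carAt (b :: P) x = if x = P.length then b else carAt P x := by
  unfold carAt
  rw [List.reverse_cons]
  rcases lt_trichotomy x P.length with h | h | h
  · rw [List.getD_append _ _ _ _ (by simpa using h), if_neg h.ne]
  · subst h
    rw [List.getD_append_right _ _ _ _ (by simp)]
    simp
  · rw [List.getD_eq_default _ _ (by simp; omega), if_neg h.ne',
      List.getD_eq_default _ _ (by simp; omega)]

theorem carAt_append (B P : List Bool) {x : ℕ} (h : x < P.length) :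
    carAt (B ++ P) x = carAt P x := by
  unfold carAt
  rw [List.reverse_append, List.getD_append _ _ _ _ (by simpa using h)]

theorem carAt_of_length_le {P : List Bool} {x : ℕ} (h : P.length ≤ x) : carAt P x = false := by
  unfold carAt
  rw [List.getD_eq_default _ _ (by simpa using h)]

open Classical in
/-- The list coding the state of the doors below `x` for the set of cars `A`. -/
noncomputable def initial (A : Set ℕ) : ℕ → List Bool
  | 0 => []
  | x + 1 => decide (x ∈ A) :: initial A x

@[simp] theorem initial_length (A : Set ℕ) (x : ℕ) : (initial A x).length = x := by
  induction x with
  | zero => rfl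
  | succ x ih => simp [initial, ih]

theorem carAt_initial {A : Set ℕ} {x y : ℕ} (h : x < y) :
    carAt (initial A y) x = true ↔ x ∈ A := by
  induction y with
  | zero => omega
  | succ y ih =>
    rw [initial, carAt_cons, initial_length]
    split_ifs with hx
    · subst hx; simp
    · exact ih (by omega)

theorem initial_eq {A : Set ℕ} {P : List Bool} (h : ∀ x < P.length, (x ∈ A ↔ carAt P x = true)) :
    initial A P.length = P := by
  classical
  induction P with
  | nil => rfl
  | cons b P ih =>
    rw [List.length_cons, initial, ih fun x hx => ?_]
    · have := h P.length (by simp)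
      rw [carAt_cons, if_pos rfl] at this
      congr 1
      rw [Bool.eq_iff_iff, decide_eq_true_iff, this]
    · rw [h x (by simp; omega), carAt_cons, if_neg hx.ne]

theorem initial_congr {A B : Set ℕ} {x : ℕ} (h : ∀ y < x, (y ∈ A ↔ y ∈ B)) :
    initial A x = initial B x := by
  have := initial_eq (A := A) (P := initial B x) fun y hy => by
    rw [initial_length] at hy
    rw [carAt_initial hy, h y hy]
  rwa [initial_length] at this

theorem initial_drop (A : Set ℕ) (x i : ℕ) : (initial A x).drop i = initial A (x - i) := by
  induction i generalizing x with
  | zero => rfl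
  | succ i ih =>
    cases x with
    | zero => simp [initial]
    | succ x => rw [initial, List.drop_succ_cons, ih, Nat.succ_sub_succ]

/-- The doors opened by a partial rule `φ`, with what was behind them, among the doors in a list. A
door is opened if it is the one that `φ` asks for; if `φ` is undefined, or asks for a door already
passed, then no more doors are opened. -/
def history (φ : List (ℕ × Bool) → Option ℕ) : List Bool → List (ℕ × Bool)
  | [] => []
  | b :: P => if φ (history φ P) = some P.length then history φ P ++ [(P.length, b)] else history φ P

/-- The set of the doors opened by a partial rule when `A` is the set of cars. -/
def openedSet (φ : List (ℕ × Bool) → Option ℕ) (A : Set ℕ) : Set ℕ :=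
  {x | φ (history φ (initial A x)) = some x}

open Classical in
theorem history_initial_succ (φ : List (ℕ × Bool) → Option ℕ) (A : Set ℕ) (x : ℕ) :
    history φ (initial A (x + 1)) = if x ∈ openedSet φ A
      then history φ (initial A x) ++ [(x, decide (x ∈ A))] else history φ (initial A x) := by
  rw [initial, history, initial_length]
  exact if_congr Iff.rfl rfl rfl

theorem adaptive_openedSet (φ : List (ℕ × Bool) → Option ℕ) : Adaptive (openedSet φ) := by
  classical
  intro A B x h
  have : history φ (initial A x) = history φ (initial B x) := by
    induction x with
    | zero => rfl
    | succ x ih =>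
      have ih := ih fun y hy => h y (by omega)
      have hm : x ∈ openedSet φ A ↔ x ∈ openedSet φ B := by
        simp only [openedSet, Set.mem_ofPred_eq, ih]
      rw [history_initial_succ, history_initial_succ, ih]
      by_cases hx : x ∈ openedSet φ A
      · rw [if_pos hx, if_pos (hm.1 hx)]
        simp only [h x (by omega) hx]
      · rw [if_neg hx, if_neg (mt hm.2 hx)]
  simp only [openedSet, Set.mem_ofPred_eq, this]

open Classical in
theorem opened_succ (O : Set ℕ → Set ℕ) (A : Set ℕ) (a y : ℕ) :
    opened O A a (y + 1) = opened O A a y + if a ≤ y ∧ y ∈ O A then 1 else 0 := by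
  by_cases h : a ≤ y
  · rw [opened_add h (Nat.le_succ y)]
    simp only [h, true_and, opened, Nat.Ico_succ_singleton, Nat.succ_eq_add_one]
    rw [Finset.filter_singleton]
    split_ifs <;> simp
  · simp [h, opened, Finset.Ico_eq_empty_of_le (show y + 1 ≤ a by omega),
      Finset.Ico_eq_empty_of_le (show y ≤ a by omega)]

open Classical in
theorem hits_succ (O : Set ℕ → Set ℕ) (A : Set ℕ) (a y : ℕ) :
    hits O A a (y + 1) = hits O A a y + if a ≤ y ∧ y ∈ O A ∧ y ∈ A then 1 else 0 := by
  by_cases h : a ≤ y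
  · rw [hits_add h (Nat.le_succ y)]
    simp only [h, true_and, hits, Nat.Ico_succ_singleton, Nat.succ_eq_add_one]
    rw [Finset.filter_singleton]
    split_ifs <;> simp
  · simp [h, hits, Finset.Ico_eq_empty_of_le (show y + 1 ≤ a by omega),
      Finset.Ico_eq_empty_of_le (show y ≤ a by omega)]

theorem history_filter_length (φ : List (ℕ × Bool) → Option ℕ) (A : Set ℕ) (a y : ℕ) :
    ((history φ (initial A y)).filter fun p => a ≤ p.1).length = opened (openedSet φ) A a y := by
  classical
  induction y with
  | zero => simp [initial, history, opened]
  | succ y ih =>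
    rw [history_initial_succ, opened_succ, ← ih]
    by_cases h : y ∈ openedSet φ A
    · by_cases h' : a ≤ y <;> simp [h, h']
    · simp [h]

theorem history_filter_hit_length (φ : List (ℕ × Bool) → Option ℕ) (A : Set ℕ) (a y : ℕ) :
    ((history φ (initial A y)).filter fun p => a ≤ p.1 ∧ p.2 = true).length =
      hits (openedSet φ) A a y := by
  classical
  induction y with
  | zero => simp [initial, history, hits]
  | succ y ih =>
    rw [history_initial_succ, hits_succ, ← ih]
    by_cases h : y ∈ openedSet φ A
    · by_cases h' : a ≤ y <;> by_cases h'' : y ∈ A <;> simp [h, h', h'']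
    · simp [h]

/-! ### The host's set, built block by block -/

/-- Of the doors from `a` on, a sequence of plays has found cars behind at most one in `s`. -/
def Fair (a s : ℕ) (σ : List (ℕ × Bool)) : Prop :=
  s * (σ.filter fun p => a ≤ p.1 ∧ p.2 = true).length ≤ (σ.filter fun p => a ≤ p.1).length

/-- The cars coded by `B`, behind the doors that follow those coded by `P`, are such that each of the
first `s` rules finds few of them, and a player going through `W` finds many at some time. -/
def Good (φ : ℕ → List (ℕ × Bool) → Option ℕ) (s : ℕ) (W : List ℕ) (P B : List Bool) : Prop :=
  (B ++ P).length = W.length ∧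
  (∀ i < B.length + 1, ∀ j < s, Fair P.length s (history (φ j) ((B ++ P).drop i))) ∧
  ∃ T < W.length + 1, P.length ≤ T ∧
    s * ((W.take T).filter fun x => carAt (B ++ P) x = false).length ≤ T

theorem fair_history_initial {φ : List (ℕ × Bool) → Option ℕ} {A : Set ℕ} {a s y : ℕ} :
    Fair a s (history φ (initial A y)) ↔
      s * hits (openedSet φ) A a y ≤ opened (openedSet φ) A a y := by
  rw [Fair, history_filter_length, history_filter_hit_length]

/-- The rules are arbitrary, with no totality or monotonicity required: any partial rule opens doors
adaptively. Hence the search for a good list also ends against the bounded approximations of the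
rules. -/
theorem exists_good {φ : ℕ → List (ℕ × Bool) → Option ℕ} {s : ℕ} {P : List Bool}
    (hP : P.length = (blockPrefix s).length) : ∃ B, Good φ s (blockPrefix (s + 1)) P B := by
  classical
  set W := blockPrefix (s + 1) with hW
  set blk := disorderedBlock s s (blockPrefix s).length (blockPrefix s).length with hblk
  have hWb : W = blockPrefix s ++ blk := rfl
  have hWl : W.length = P.length + blk.length := by rw [hWb, List.length_append, hP]
  set A₀ : Set ℕ := {x | carAt P x = true} with hA₀
  have hA₀lt : ∀ x ∈ A₀, x < P.length := fun x hx => by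
    by_contra h
    have := carAt_of_length_le (not_lt.1 h)
    simp only [hA₀, Set.mem_ofPred_eq] at hx
    simp [hx] at this
  have hA₀P : initial A₀ P.length = P := initial_eq fun x _ => by simp [hA₀]
  suffices h : ∃ A : Set ℕ, (∀ x < P.length, (x ∈ A ↔ x ∈ A₀)) ∧
      (∀ y ≤ W.length, ∀ j < s, s * hits (openedSet (φ j)) A P.length y ≤
        opened (openedSet (φ j)) A P.length y) ∧
      ∃ T ≤ W.length, P.length ≤ T ∧
        s * ((W.take T).filter fun x => carAt (initial A W.length) x = false).length ≤ T by
    obtain ⟨A, hA1, hA2, T, hT1, hT2, hT3⟩ := h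
    have hQ : (initial A W.length).take blk.length ++ P = initial A W.length := by
      conv_rhs => rw [← List.take_append_drop blk.length (initial A W.length)]
      rw [initial_drop, hWl, Nat.add_sub_cancel, initial_congr hA1, hA₀P]
    refine ⟨(initial A W.length).take blk.length, ?_, ?_, T, by omega, hT2, ?_⟩
    · rw [hQ, initial_length]
    · intro i _ j hj
      rw [hQ, initial_drop, fair_history_initial]
      exact hA2 _ (Nat.sub_le _ _) j hj
    · rwa [hQ]
  -- For s below 2 both inequalities hold trivially, and no car is added.
  rcases Nat.lt_or_ge s 2 with hs | hs
  · refine ⟨A₀, fun x _ => Iff.rfl, fun y _ j _ => ?_, W.length, le_rfl, by omega, ?_⟩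
    · exact le_trans (Nat.mul_le_mul_right _ (by omega : s ≤ 1))
        (by rw [one_mul]; exact hits_le_opened)
    · refine le_trans (Nat.mul_le_mul_right _ (by omega : s ≤ 1)) ?_
      rw [one_mul, List.take_length]
      exact List.length_filter_le _ _
  -- All s contestants are unrestricted, which the level s just allows; the condition on restricted
  -- ones is void.
  · obtain ⟨B, hB1, hB2, -, n, hn, hB4⟩ := solvable_disorderedBlock hs
      (O := fun j => openedSet (φ j)) (fun j => adaptive_openedSet _) s (blockPrefix s).length
      (blockPrefix s).length A₀ (Finset.range s) (by rwa [← hP]) (by simp)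
      (fun j hj hj' => absurd (Finset.mem_range.2 hj) hj')
    rw [← hblk, ← hP] at hB1 hB2
    rw [← hblk] at hn hB4
    rw [← hP] at hB4
    refine ⟨A₀ ∪ B, fun x hx => ?_, fun y hy j hj => ?_, P.length + n, by omega, by omega, ?_⟩
    · simp only [Set.mem_union, or_iff_left_iff_imp]
      intro hxB
      have := (hB1 x hxB).1
      omega
    · exact hB2 j hj (Finset.mem_range.2 hj) y (by omega)
    · refine le_trans (Nat.mul_le_mul_left s ?_) hB4
      rw [hWb, hP, List.take_length_add_append, List.filter_append, List.length_append]
      refine Nat.add_le_add (List.length_filter_le _ _) ?_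
      unfold missCount
      simp only [← List.countP_eq_length_filter]
      refine List.countP_mono_left fun x hx h => ?_
      simp only [decide_eq_true_eq] at h ⊢
      intro hxB
      have h1 := (carAt_initial (A := A₀ ∪ B) (x := x) (y := (blockPrefix s ++ blk).length)
        (by rw [← hWb, hWl]; exact (hB1 x hxB).2)).2 (Or.inr hxB)
      rw [h] at h1
      exact absurd h1 (by simp)

/-- The list of truth values with code `n`. -/
def bitList (n : ℕ) : List Bool := (Encodable.decode n).getD []

open Classical in
/-- The cars in the first `s` blocks, those in each block being given by the first good list. -/
noncomputable def build (φ : ℕ → List (ℕ × Bool) → Option ℕ) : ℕ → List Bool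
  | 0 => []
  | s + 1 => (if h : ∃ n, Good φ s (blockPrefix (s + 1)) (build φ s)
      (bitList n) then bitList (Nat.find h) else []) ++
        build φ s

section Build

variable (φ : ℕ → List (ℕ × Bool) → Option ℕ) (s : ℕ)

theorem exists_good_ofNat {φ : ℕ → List (ℕ × Bool) → Option ℕ} {s : ℕ} {P : List Bool}
    (hP : P.length = (blockPrefix s).length) :
    ∃ n, Good φ s (blockPrefix (s + 1)) P (bitList n) := by
  obtain ⟨B, hB⟩ := exists_good (φ := φ) hP
  exact ⟨Encodable.encode B, by rwa [bitList, Encodable.encodek]⟩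

theorem build_length : (build φ s).length = (blockPrefix s).length := by
  classical
  induction s with
  | zero => rfl
  | succ s ih =>
    have h := exists_good_ofNat (φ := φ) ih
    rw [build, dif_pos h]
    exact (Nat.find_spec h).1

open Classical in
theorem build_succ : build φ (s + 1) =
    bitList (Nat.find (exists_good_ofNat (φ := φ) (build_length φ s))) ++
      build φ s := by
  rw [build, dif_pos (exists_good_ofNat (build_length φ s))]

theorem build_good : ∃ B, build φ (s + 1) = B ++ build φ s ∧
    Good φ s (blockPrefix (s + 1)) (build φ s) B := by
  classical
  exact ⟨_, build_succ φ s, Nat.find_spec (exists_good_ofNat (build_length φ s))⟩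

theorem carAt_build_of_le {φ : ℕ → List (ℕ × Bool) → Option ℕ} {s t x : ℕ} (hst : s ≤ t)
    (hx : x < (blockPrefix s).length) : carAt (build φ t) x = carAt (build φ s) x := by
  induction t, hst using Nat.le_induction with
  | base => rfl
  | succ t hst ih =>
    obtain ⟨B, hB, -⟩ := build_good φ t
    rw [hB, carAt_append, ih]
    rw [build_length]
    exact lt_of_lt_of_le hx (blockPrefix_prefix hst).length_le

/-- The set of cars placed against the sequence of rules `φ`. -/
def carSet : Set ℕ := {x | carAt (build φ (x + 1)) x = true}

theorem initial_carSet : initial (carSet φ) (blockPrefix s).length = build φ s := by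
  rw [← build_length φ s]
  refine initial_eq fun x hx => ?_
  rw [build_length] at hx
  simp only [carSet, Set.mem_ofPred_eq]
  rw [← carAt_build_of_le (le_max_left (x + 1) s) (le_blockPrefix_length (x + 1)),
    carAt_build_of_le (le_max_right (x + 1) s) hx]

theorem hits_carSet_le {j s y : ℕ} (hj : j < s) (h1 : (blockPrefix s).length ≤ y)
    (h2 : y ≤ (blockPrefix (s + 1)).length) :
    s * hits (openedSet (φ j)) (carSet φ) (blockPrefix s).length y ≤
      opened (openedSet (φ j)) (carSet φ) (blockPrefix s).length y := by
  obtain ⟨B, hB, hl, hfair, -⟩ := build_good φ s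
  -- The lists are reversed, so dropping entries at the front restricts the play to the doors below
  -- `y`.
  have := hfair ((blockPrefix (s + 1)).length - y)
    (by rw [List.length_append, build_length] at hl; omega) j hj
  rw [← hB, ← initial_carSet φ (s + 1), initial_drop, build_length, fair_history_initial] at this
  rwa [show (blockPrefix (s + 1)).length - ((blockPrefix (s + 1)).length - y) = y by omega] at this

theorem exists_time_carSet : ∃ T, s ≤ T ∧ T ≤ (blockPrefix (s + 1)).length ∧
    s * missCount (carSet φ) ((blockPrefix (s + 1)).take T) ≤ T := by
  classical
  obtain ⟨B, hB, -, -, T, hT1, hT2, hT3⟩ := build_good φ s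
  rw [build_length] at hT2
  refine ⟨T, (le_blockPrefix_length s).trans hT2, by omega, le_trans (Nat.mul_le_mul_left s ?_) hT3⟩
  unfold missCount
  simp only [← List.countP_eq_length_filter]
  refine List.countP_mono_left fun x hx h => ?_
  simp only [decide_eq_true_eq] at h ⊢
  rw [← hB, ← initial_carSet φ (s + 1), ← Bool.not_eq_true, carAt_initial]
  · exact h
  · have := (blockPrefix_perm (s + 1)).mem_iff.1 (List.mem_of_mem_take hx)
    exact List.mem_range.1 this

end Build

/-! ### Stagewise approximation and reducibility to the halting problem -/

open Filter

/-- The approximation at stage `k` to the sequence of all partial computable rules. -/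
def stageRule (k j : ℕ) (σ : List (ℕ × Bool)) : Option ℕ :=
  Code.evaln k (ofNat Code j) (encode σ)

open Classical in
/-- The sequence of all partial computable rules. -/
noncomputable def rule (j : ℕ) (σ : List (ℕ × Bool)) : Option ℕ :=
  ((ofNat Code j).eval (encode σ)).toOption

theorem eventually_stageRule (j : ℕ) (σ : List (ℕ × Bool)) :
    ∀ᶠ k in atTop, stageRule k j σ = rule j σ := by
  classical
  unfold stageRule rule
  by_cases h : ((ofNat Code j).eval (encode σ)).Dom
  · obtain ⟨v, hv⟩ := Part.dom_iff_mem.1 h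
    obtain ⟨K, hK⟩ := Code.evaln_complete.1 hv
    filter_upwards [eventually_ge_atTop K] with k hk
    rw [Option.mem_def.1 (Code.evaln_mono hk hK), Part.eq_some_iff.2 hv]
    simp
  · refine Eventually.of_forall fun k => ?_
    rw [(Part.toOption_eq_none _).2 h, Option.eq_none_iff_forall_not_mem]
    exact fun v hv => h (Part.dom_iff_mem.2 ⟨v, Code.evaln_sound hv⟩)

theorem eventually_history (j : ℕ) (P : List Bool) :
    ∀ᶠ k in atTop, history (stageRule k j) P = history (rule j) P := by
  induction P with
  | nil => simp [history]
  | cons b P ih =>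
    filter_upwards [ih, eventually_stageRule j (history (rule j) P)] with k h1 h2
    rw [history, history, h1, h2]

/-- Whether a list is good involves only finitely many histories, each of which stabilises. -/
theorem eventually_good (s : ℕ) (W : List ℕ) (P B : List Bool) :
    ∀ᶠ k in atTop, (Good (stageRule k) s W P B ↔ Good rule s W P B) := by
  have h : ∀ᶠ k in atTop, ∀ i ∈ Finset.range (B.length + 1), ∀ j ∈ Finset.range s,
      history (stageRule k j) ((B ++ P).drop i) = history (rule j) ((B ++ P).drop i) := by
    simp only [eventually_all_finset]
    exact fun i _ j _ => eventually_history _ _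
  filter_upwards [h] with k hk
  unfold Good
  refine and_congr Iff.rfl (and_congr ?_ Iff.rfl)
  refine forall₂_congr fun i hi => forall₂_congr fun j hj => ?_
  rw [hk i (Finset.mem_range.2 hi) j (Finset.mem_range.2 hj)]

theorem build_succ_of_first {φ : ℕ → List (ℕ × Bool) → Option ℕ} {s n : ℕ}
    (h : Good φ s (blockPrefix (s + 1)) (build φ s) (bitList n))
    (h' : ∀ m < n, ¬ Good φ s (blockPrefix (s + 1)) (build φ s) (bitList m)) :
    build φ (s + 1) = bitList n ++ build φ s := by
  classical
  rw [build_succ, (Nat.find_eq_iff _).2 ⟨h, h'⟩]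

open Classical in
theorem exists_first_good (φ : ℕ → List (ℕ × Bool) → Option ℕ) (s : ℕ) :
    ∃ n, Good φ s (blockPrefix (s + 1)) (build φ s) (bitList n) ∧
      ∀ m < n, ¬ Good φ s (blockPrefix (s + 1)) (build φ s) (bitList m) :=
  ⟨_, (Nat.find_eq_iff (exists_good_ofNat (build_length φ s))).1 rfl⟩

/-- The first good code `n` is settled once the verdicts on all codes up to `n` have settled. -/
theorem eventually_build (s : ℕ) : ∀ᶠ k in atTop, build (stageRule k) s = build rule s := by
  induction s with
  | zero => simp [build]
  | succ s ih =>
    obtain ⟨n, hn, hn'⟩ := exists_first_good rule s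
    have h : ∀ᶠ k in atTop, ∀ m ∈ Finset.range (n + 1),
        (Good (stageRule k) s (blockPrefix (s + 1)) (build rule s) (bitList m) ↔
          Good rule s (blockPrefix (s + 1)) (build rule s) (bitList m)) := by
      rw [eventually_all_finset]
      exact fun m _ => eventually_good _ _ _ _
    filter_upwards [ih, h] with k h1 h2
    rw [build_succ_of_first hn hn', build_succ_of_first (n := n), h1]
    · rw [h1]; exact (h2 n (by simp)).2 hn
    · intro m hm
      rw [h1, h2 m (Finset.mem_range.2 (by omega))]
      exact hn' m hm

theorem primrec_stageRule :
    Primrec fun q : (ℕ × ℕ) × List (ℕ × Bool) => stageRule q.1.1 q.1.2 q.2 :=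
  Code.primrec_evaln.comp (((Primrec.fst.comp Primrec.fst).pair
    ((Primrec.ofNat Code).comp (Primrec.snd.comp Primrec.fst))).pair
      (Primrec.encode.comp Primrec.snd))

theorem primrec_history :
    Primrec fun q : (ℕ × ℕ) × List Bool => history (stageRule q.1.1 q.1.2) q.2 := by
  have hq := Primrec.fst (α := (ℕ × ℕ) × List Bool) (β := Bool × List Bool × List (ℕ × Bool))
  have hy := Primrec.snd (α := (ℕ × ℕ) × List Bool) (β := Bool × List Bool × List (ℕ × Bool))
  have hσ := Primrec.snd.comp (Primrec.snd.comp hy)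
  have hl := Primrec.list_length.comp (Primrec.fst.comp (Primrec.snd.comp hy))
  have h1 : Primrec₂ fun (q : (ℕ × ℕ) × List Bool) (y : Bool × List Bool × List (ℕ × Bool)) =>
      if stageRule q.1.1 q.1.2 y.2.2 = some y.2.1.length
        then y.2.2 ++ [(y.2.1.length, y.1)] else y.2.2 :=
    Primrec.ite (Primrec.eq.comp (primrec_stageRule.comp ((Primrec.fst.comp hq).pair hσ))
      (Primrec.option_some.comp hl))
      (Primrec.list_concat.comp hσ (hl.pair (Primrec.fst.comp hy))) hσ
  refine (Primrec.list_rec Primrec.snd (Primrec.const []) h1).of_eq fun q => ?_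
  obtain ⟨p, P⟩ := q
  induction P with
  | nil => rfl
  | cons b P ih =>
    rw [history, ← ih]

theorem primrecPred_fair :
    PrimrecPred fun q : (ℕ × ℕ) × List (ℕ × Bool) => Fair q.1.1 q.1.2 q.2 := by
  have ha := Primrec.fst.comp (Primrec.fst (α := ℕ × ℕ) (β := List (ℕ × Bool)))
  have hs := Primrec.snd.comp (Primrec.fst (α := ℕ × ℕ) (β := List (ℕ × Bool)))
  have h1 : PrimrecRel fun (p : ℕ × Bool) (a : ℕ) => a ≤ p.1 :=
    Primrec.nat_le.comp Primrec.snd (Primrec.fst.comp Primrec.fst)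
  have h2 : PrimrecRel fun (p : ℕ × Bool) (a : ℕ) => a ≤ p.1 ∧ p.2 = true :=
    h1.and (Primrec.eq.comp (Primrec.snd.comp Primrec.fst) (Primrec.const true))
  exact Primrec.nat_le.comp
    (Primrec.nat_mul.comp hs (Primrec.list_length.comp (h2.listFilter.comp Primrec.snd ha)))
    (Primrec.list_length.comp (h1.listFilter.comp Primrec.snd ha))

theorem primrec_carAt : Primrec₂ carAt :=
  (Primrec.list_getD false).comp (Primrec.list_reverse.comp Primrec.fst) Primrec.snd

theorem forall_lt_of_primrecRel {α : Type*} [Primcodable α] {R : ℕ → α → Prop}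
    (hR : PrimrecRel R) : PrimrecRel fun (n : ℕ) (a : α) => ∀ i < n, R i a :=
  (hR.forall_mem_list.comp (Primrec.list_range.comp Primrec.fst) Primrec.snd).of_eq fun p => by
    simp

theorem exists_lt_of_primrecRel {α : Type*} [Primcodable α] {R : ℕ → α → Prop}
    (hR : PrimrecRel R) : PrimrecRel fun (n : ℕ) (a : α) => ∃ i < n, R i a :=
  (hR.exists_mem_list.comp (Primrec.list_range.comp Primrec.fst) Primrec.snd).of_eq fun p => by
    simp

theorem primrecPred_good : PrimrecPred
    fun q : ((ℕ × ℕ) × List ℕ) × (List Bool × List Bool) =>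
      Good (stageRule q.1.1.1) q.1.1.2 q.1.2 q.2.1 q.2.2 := by
  have hks := Primrec.fst.comp
    (Primrec.fst (α := (ℕ × ℕ) × List ℕ) (β := List Bool × List Bool))
  have hW := Primrec.snd.comp
    (Primrec.fst (α := (ℕ × ℕ) × List ℕ) (β := List Bool × List Bool))
  have hP := Primrec.fst.comp
    (Primrec.snd (α := (ℕ × ℕ) × List ℕ) (β := List Bool × List Bool))
  have hB := Primrec.snd.comp
    (Primrec.snd (α := (ℕ × ℕ) × List ℕ) (β := List Bool × List Bool))
  have hQ := Primrec.list_append.comp hB hP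
  have hs := Primrec.snd.comp hks
  have h1 := Primrec.eq.comp (Primrec.list_length.comp hQ) (Primrec.list_length.comp hW)
  have h2 : PrimrecRel fun (j : ℕ) (r : ℕ × ((ℕ × ℕ) × List ℕ) × (List Bool × List Bool)) =>
      Fair r.2.2.1.length r.2.1.1.2
        (history (stageRule r.2.1.1.1 j) ((r.2.2.2 ++ r.2.2.1).drop r.1)) := by
    have hq := Primrec.snd.comp (Primrec.snd (α := ℕ)
      (β := ℕ × ((ℕ × ℕ) × List ℕ) × (List Bool × List Bool)))
    have hi := Primrec.fst.comp (Primrec.snd (α := ℕ)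
      (β := ℕ × ((ℕ × ℕ) × List ℕ) × (List Bool × List Bool)))
    exact primrecPred_fair.comp (((Primrec.list_length.comp (hP.comp hq)).pair (hs.comp hq)).pair
      (primrec_history.comp ((((Primrec.fst.comp hks).comp hq).pair Primrec.fst).pair
        (Primrec.list_drop.comp hi (hQ.comp hq)))))
  have h3 : PrimrecRel fun (i : ℕ) (q : ((ℕ × ℕ) × List ℕ) × (List Bool × List Bool)) =>
      ∀ j < q.1.1.2, Fair q.2.1.length q.1.1.2
        (history (stageRule q.1.1.1 j) ((q.2.2 ++ q.2.1).drop i)) :=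
    (forall_lt_of_primrecRel h2).comp (hs.comp Primrec.snd) Primrec.id
  have h4 := (forall_lt_of_primrecRel h3).comp (Primrec.succ.comp (Primrec.list_length.comp hB))
    Primrec.id
  have h5 : PrimrecRel fun (x : ℕ) (Q : List Bool) => carAt Q x = false :=
    Primrec.eq.comp (primrec_carAt.comp Primrec.snd Primrec.fst) (Primrec.const false)
  have h6 : PrimrecRel fun (T : ℕ) (q : ((ℕ × ℕ) × List ℕ) × (List Bool × List Bool)) =>
      q.2.1.length ≤ T ∧
        q.1.1.2 * ((q.1.2.take T).filter fun x => carAt (q.2.2 ++ q.2.1) x = false).length ≤ T := by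
    have hq := Primrec.snd (α := ℕ) (β := ((ℕ × ℕ) × List ℕ) × (List Bool × List Bool))
    exact (Primrec.nat_le.comp (Primrec.list_length.comp (hP.comp hq)) Primrec.fst).and
      (Primrec.nat_le.comp (Primrec.nat_mul.comp (hs.comp hq) (Primrec.list_length.comp
        (h5.listFilter.comp (Primrec.list_take.comp Primrec.fst (hW.comp hq)) (hQ.comp hq))))
        Primrec.fst)
  have h7 := (exists_lt_of_primrecRel h6).comp (Primrec.succ.comp (Primrec.list_length.comp hW))
    Primrec.id
  exact h1.and (h4.and h7)

theorem primrec_bitList : Primrec bitList :=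
  Primrec.option_getD.comp Primrec.decode (Primrec.const [])

open Classical in
theorem computable_build : Computable₂ fun k s : ℕ => build (stageRule k) s := by
  have h1 : Partrec₂ fun (q : (ℕ × ℕ) × ℕ × List Bool) (n : ℕ) =>
      (Part.some (decide (Good (stageRule q.1.1) q.2.1 (blockPrefix (q.2.1 + 1)) q.2.2
        (bitList n))) : Part Bool) := by
    have hq := Computable.fst (α := (ℕ × ℕ) × ℕ × List Bool) (β := ℕ)
    have hs := Computable.fst.comp (Computable.snd.comp hq)
    exact (primrecPred_good.decide.to_comp.comp
      ((((Computable.fst.comp (Computable.fst.comp hq)).pair hs).pair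
        (computable_blockPrefix.comp (Computable.succ.comp hs))).pair
          ((Computable.snd.comp (Computable.snd.comp hq)).pair
            (primrec_bitList.to_comp.comp Computable.snd)))).partrec
  have h2 : Computable₂ fun (q : (ℕ × ℕ) × ℕ × List Bool) (n : ℕ) => bitList n ++ q.2.2 :=
    (Primrec.list_append.comp (primrec_bitList.comp Primrec.snd)
      (Primrec.snd.comp (Primrec.snd.comp Primrec.fst))).to_comp
  have h3 := (Partrec.rfind h1).map h2
  have h4 : Computable fun _ : ℕ × ℕ => ([] : List Bool) := Computable.const []
  have key : ∀ k s : ℕ, (Nat.rec (Part.some []) (fun y IH => IH.bind fun P =>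
      (Nat.rfind fun n => (Part.some (decide (Good (stageRule k) y (blockPrefix (y + 1)) P
        (bitList n))) : Part Bool)).map fun n => bitList n ++ P) s : Part (List Bool)) =
      Part.some (build (stageRule k) s) := by
    intro k s
    induction s with
    | zero => rfl
    | succ s ih =>
      simp only [ih, Part.bind_some]
      obtain ⟨n, hn, hn'⟩ := exists_first_good (stageRule k) s
      rw [build_succ_of_first hn hn']
      have : Nat.rfind (fun n => (Part.some (decide (Good (stageRule k) s (blockPrefix (s + 1))
          (build (stageRule k) s) (bitList n))) : Part Bool)) = Part.some n :=
        Part.eq_some_iff.2 (Nat.mem_rfind.2 ⟨by simpa using hn, fun {m} hm => by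
          simpa using hn' m hm⟩)
      rw [this, Part.map_some]
  exact (Partrec.nat_rec Computable.snd h4.partrec h3.to₂).of_eq fun q => key q.1 q.2

theorem carSet_reducible : SetTuringReducible (carSet rule) haltingSet := by
  have h : Computable₂ fun x k : ℕ => carAt (build (stageRule k) (x + 1)) x :=
    primrec_carAt.to_comp.comp (computable_build.comp Computable.snd
      (Computable.succ.comp Computable.fst)) Computable.fst
  refine setTuringReducible_haltingSet_of_limit h fun x => ?_
  obtain ⟨K, hK⟩ := eventually_atTop.1 (eventually_build (x + 1))
  refine ⟨K, fun k hk => ?_⟩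
  rw [hK k hk]
  rfl

/-! ### Densities from counting inequalities -/

section Density

variable {A : Set ℕ}

theorem densityAt_nonneg (A : Set ℕ) (n : ℕ) : 0 ≤ densityAt A n := by
  unfold densityAt; positivity

theorem densityAt_le_one (A : Set ℕ) (n : ℕ) : densityAt A n ≤ 1 := by
  classical
  refine div_le_one_of_le₀ ?_ (Nat.cast_nonneg n)
  exact_mod_cast (Finset.card_filter_le _ _).trans (Finset.card_range n).le

theorem upperDensity_le_one (A : Set ℕ) : upperDensity A ≤ 1 :=
  limsup_le_of_le (isCoboundedUnder_le_of_le atTop (densityAt_nonneg A))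
    (Eventually.of_forall (densityAt_le_one A))

open Classical in
theorem hasDensity_zero (h : ∀ S : ℕ, ∃ K, ∀ n,
    S * ((Finset.range n).filter (fun k => k ∈ A)).card ≤ K + n) : HasDensity A 0 := by
  have : Tendsto (densityAt A) atTop (nhds 0) := by
    rw [Metric.tendsto_atTop]
    intro ε hε
    obtain ⟨S, hS⟩ := exists_nat_gt (2 / ε)
    obtain ⟨K, hK⟩ := h S
    refine ⟨K + 1, fun n hn => ?_⟩
    rw [Real.dist_eq, sub_zero, abs_of_nonneg (densityAt_nonneg A n)]
    have hn0 : (0 : ℝ) < n := by exact_mod_cast (show 0 < n by omega)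
    unfold densityAt
    rw [div_lt_iff₀ hn0]
    rw [div_lt_iff₀ hε] at hS
    have h1 : (S : ℝ) * (((Finset.range n).filter (fun k => k ∈ A)).card : ℝ) ≤ 2 * n := by
      exact_mod_cast (show S * ((Finset.range n).filter (fun k => k ∈ A)).card ≤ 2 * n by
        have := hK n; omega)
    have hS0 : (0 : ℝ) < S := by
      by_contra hS0
      have : (S : ℝ) * ε ≤ 0 := mul_nonpos_of_nonpos_of_nonneg (not_lt.1 hS0) hε.le
      linarith
    refine lt_of_mul_lt_mul_left (lt_of_le_of_lt h1 ?_) hS0.le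
    calc (2 : ℝ) * n < S * ε * n := mul_lt_mul_of_pos_right hS hn0
      _ = S * (ε * n) := by ring
  exact ⟨this.limsup_eq, this.liminf_eq⟩

open Classical in
theorem card_filter_add_card_filter_not (n : ℕ) :
    ((Finset.range n).filter (fun k => k ∈ A)).card +
      ((Finset.range n).filter (fun k => k ∉ A)).card = n := by
  rw [Finset.card_filter_add_card_filter_not, Finset.card_range]

open Classical in
theorem upperDensity_eq_one (h : ∀ s : ℕ, ∃ T, s ≤ T ∧
    s * ((Finset.range T).filter (fun k => k ∉ A)).card ≤ T) : upperDensity A = 1 := by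
  refine le_antisymm (upperDensity_le_one A) (le_of_forall_lt fun b hb => ?_)
  obtain ⟨c, hbc, hc⟩ := exists_between hb
  refine lt_of_lt_of_le hbc (le_limsup_of_frequently_le ?_
    (isBoundedUnder_of ⟨1, densityAt_le_one A⟩))
  rw [frequently_atTop]
  intro N
  obtain ⟨S, hS⟩ := exists_nat_gt (1 / (1 - c))
  -- `N` makes the time late, `S` makes the misses rare, and 1 keeps `T` positive.
  obtain ⟨T, hT1, hT2⟩ := h (max (max N S) 1)
  refine ⟨T, by omega, ?_⟩
  have hT0 : (0 : ℝ) < T := by exact_mod_cast (show 0 < T by omega)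
  have h1 := card_filter_add_card_filter_not (A := A) T
  have hST : S * ((Finset.range T).filter (fun k => k ∉ A)).card ≤ T :=
    (Nat.mul_le_mul_right _ (by omega)).trans hT2
  set x := ((Finset.range T).filter (fun k => k ∈ A)).card with hx
  set y := ((Finset.range T).filter (fun k => k ∉ A)).card with hy
  have h1' : (x : ℝ) + y = T := by exact_mod_cast h1
  have hST' : (S : ℝ) * y ≤ T := by exact_mod_cast hST
  unfold densityAt
  rw [← hx, le_div_iff₀ hT0]
  have hc' : 0 < 1 - c := by linarith
  rw [div_lt_iff₀ hc'] at hS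
  have hS0 : (0 : ℝ) < S := by
    by_contra hS0
    have : (S : ℝ) * (1 - c) ≤ 0 := mul_nonpos_of_nonpos_of_nonneg (not_lt.1 hS0) hc'.le
    linarith
  have : (y : ℝ) ≤ (1 - c) * T := by
    refine le_of_mul_le_mul_left ?_ hS0
    nlinarith [mul_pos hT0 hc']
  linarith

open Classical in
theorem infinite_of_miss {f : ℕ → ℕ} (hf : Function.Injective f) (h : ∀ s : ℕ, ∃ T, s ≤ T ∧
    s * ((Finset.range T).filter (fun k => k ∉ f ⁻¹' A)).card ≤ T) : A.Infinite := by
  intro hA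
  have hfin := hA.preimage (f := f) hf.injOn
  -- If the preimage had c elements, a time `T` of at least 2c + 2 with at most half of the times
  -- missed would leave more than c hits.
  obtain ⟨T, hT1, hT2⟩ := h (2 * hfin.toFinset.card + 2)
  have h1 := card_filter_add_card_filter_not (A := f ⁻¹' A) T
  have h2 : ((Finset.range T).filter (fun k => k ∈ f ⁻¹' A)).card ≤ hfin.toFinset.card :=
    Finset.card_le_card fun x hx => by simpa using (Finset.mem_filter.1 hx).2
  have h3 := (Nat.mul_le_mul_right
    ((Finset.range T).filter (fun k => k ∉ f ⁻¹' A)).card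
    (by omega : 2 ≤ 2 * hfin.toFinset.card + 2)).trans hT2
  omega

end Density

/-! ### From single blocks to the whole set -/

theorem take_blockPrefix {n T : ℕ} (h : T ≤ (blockPrefix n).length) :
    (blockPrefix n).take T = (List.range T).map blockInjection := by
  refine List.ext_getElem (by simpa using h) fun i h1 h2 => ?_
  simp only [List.length_map, List.length_range] at h2
  rw [List.getElem_take, List.getElem_map, List.getElem_range, blockInjection_eq (n := n) (by omega),
    List.getD_eq_getElem]

open Classical in
theorem missCount_map_range (A : Set ℕ) (f : ℕ → ℕ) (T : ℕ) :
    missCount A ((List.range T).map f) =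
      ((Finset.range T).filter (fun k => k ∉ f ⁻¹' A)).card := by
  induction T with
  | zero => simp [missCount]
  | succ T ih =>
    rw [List.range_succ, List.map_append, missCount_append, ih, Finset.range_add_one,
      Finset.filter_insert]
    by_cases h : f T ∈ A
    · simp [missCount, h]
    · simp [missCount, h]

open Classical in
theorem exists_time_miss_carSet (φ : ℕ → List (ℕ × Bool) → Option ℕ) (s : ℕ) :
    ∃ T, s ≤ T ∧
      s * ((Finset.range T).filter (fun k => k ∉ blockInjection ⁻¹' carSet φ)).card ≤ T := by
  obtain ⟨T, h1, h2, h3⟩ := exists_time_carSet φ s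
  refine ⟨T, h1, ?_⟩
  rwa [take_blockPrefix h2, missCount_map_range] at h3

/-- The bounds with factor s ≥ S hold at every point of each later block, so they add up over
complete blocks and the part of the current one. -/
theorem mul_hits_le_opened (φ : ℕ → List (ℕ × Bool) → Option ℕ) {j S y : ℕ} (hj : j < S)
    (hy : (blockPrefix S).length ≤ y) :
    S * hits (openedSet (φ j)) (carSet φ) (blockPrefix S).length y ≤
      opened (openedSet (φ j)) (carSet φ) (blockPrefix S).length y := by
  have key : ∀ s, S ≤ s → ∀ y, (blockPrefix S).length ≤ y → y ≤ (blockPrefix s).length →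
      S * hits (openedSet (φ j)) (carSet φ) (blockPrefix S).length y ≤
        opened (openedSet (φ j)) (carSet φ) (blockPrefix S).length y := by
    intro s hs
    induction s, hs using Nat.le_induction with
    | base =>
      intro y _ hy
      rw [hits_eq_zero_of_le hy]
      simp
    | succ s hs ih =>
      intro y hy1 hy2
      rcases le_total y (blockPrefix s).length with h | h
      · exact ih y hy1 h
      · have hS := (blockPrefix_prefix hs).length_le
        rw [hits_add hS h, opened_add hS h, Nat.mul_add]
        exact Nat.add_le_add (ih _ hS le_rfl)
          ((Nat.mul_le_mul_right _ hs).trans (hits_carSet_le φ (by omega) h hy2))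
  exact key (max S y) (le_max_left _ _) y hy
    ((le_max_right _ _).trans (le_blockPrefix_length _))

/-! ### Skip rules and functional contestants as partial rules -/

section Play

variable {f : List (ℕ × Bool) → ℕ} {φ : List (ℕ × Bool) → Option ℕ} {A : Set ℕ}

/-- `history` scans all doors in increasing order. While it waits for the next requested door its
state does not change, and since the requested doors increase along the play none of them has been
passed. -/
theorem history_eq_skipPlay (hφ : ∀ σ, φ σ = some (f σ))
    (hd : StrictMono fun n => f (skipPlay f A n)) (n : ℕ) :
    history φ (initial A (f (skipPlay f A n))) = skipPlay f A n := by
  classical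
  have hmem : ∀ x, x ∈ openedSet φ A ↔ f (history φ (initial A x)) = x := by
    intro x
    simp only [openedSet, Set.mem_ofPred_eq, hφ, Option.some_inj]
  have step : ∀ n x, history φ (initial A x) = skipPlay f A n → x ≤ f (skipPlay f A n) →
      history φ (initial A (f (skipPlay f A n))) = skipPlay f A n := by
    intro n x hx hle
    have : ∀ k, x + k ≤ f (skipPlay f A n) → history φ (initial A (x + k)) = skipPlay f A n := by
      intro k
      induction k with
      | zero => exact fun _ => hx
      | succ k ih =>
        intro hk
        have ih := ih (by omega)
        rw [← add_assoc, history_initial_succ, if_neg, ih]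
        rw [hmem, ih]
        omega
    have := this (f (skipPlay f A n) - x) (by omega)
    rwa [Nat.add_sub_cancel' hle] at this
  induction n with
  | zero => exact step 0 0 rfl (Nat.zero_le _)
  | succ n ih =>
    refine step (n + 1) (f (skipPlay f A n) + 1) ?_ (hd (Nat.lt_succ_self n))
    rw [history_initial_succ, if_pos ((hmem _).2 (by rw [ih])), ih, skipPlay]

theorem skipPlay_length (n : ℕ) : (skipPlay f A n).length = n := by
  induction n with
  | zero => rfl
  | succ n ih => simp [skipPlay, ih]

open Classical in
theorem skipPlay_filter_length (n : ℕ) :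
    ((skipPlay f A n).filter fun p => 0 ≤ p.1 ∧ p.2 = true).length =
      ((Finset.range n).filter (fun k => k ∈ skipSelect f A)).card := by
  induction n with
  | zero => simp [skipPlay]
  | succ n ih =>
    rw [skipPlay, List.filter_append, List.length_append, ih, Finset.range_add_one,
      Finset.filter_insert]
    by_cases h : f (skipPlay f A n) ∈ A
    · rw [if_pos (show n ∈ skipSelect f A from h), Finset.card_insert_of_notMem (by simp)]
      simp [h]
    · rw [if_neg (show n ∉ skipSelect f A from h)]
      simp [h]

end Play

theorem exists_rule_eq {f : List (ℕ × Bool) → ℕ} (hf : Computable f) :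
    ∃ j, ∀ σ, rule j σ = some (f σ) := by
  classical
  obtain ⟨c, hc⟩ := Code.exists_code.1 hf
  refine ⟨encode c, fun σ => ?_⟩
  simp [rule, hc, ofNat_encode]

/-- The set of cars constructed above beats every contestant given by a computable function, even
one that would not be a skip rule against other sets. -/
theorem hasDensity_skipSelect_carSet {f : List (ℕ × Bool) → ℕ} (hf : Computable f)
    (hd : StrictMono fun n => f (skipPlay f (carSet rule) n)) :
    HasDensity (skipSelect f (carSet rule)) 0 := by
  classical
  obtain ⟨j, hj⟩ := exists_rule_eq hf
  refine hasDensity_zero fun S => ?_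
  -- From block `S'` on, rule `j` is among those being controlled, with ratio at least `S`. The cars
  -- behind the `a` doors before that are absorbed in the constant `S * a`.
  set S' := max S (j + 1) with hS'
  set a := (blockPrefix S').length with ha
  refine ⟨S * a, fun n => ?_⟩
  set O := openedSet (rule j) with hO
  set y := f (skipPlay f (carSet rule) n) with hy
  have hplay := history_eq_skipPlay hj hd n
  have h1 : ((Finset.range n).filter (fun k => k ∈ skipSelect f (carSet rule))).card =
      hits O (carSet rule) 0 y := by
    rw [← skipPlay_filter_length, ← hplay, history_filter_hit_length]
  have h2 : n = opened O (carSet rule) 0 y := by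
    rw [← history_filter_length, hplay]
    simp [skipPlay_length]
  have hle : ∀ b, hits O (carSet rule) 0 b ≤ b := fun b =>
    (Finset.card_filter_le _ _).trans (by simp)
  rw [h1, h2]
  rcases le_total y a with h | h
  · exact le_add_right (Nat.mul_le_mul_left _ ((hle y).trans h))
  · rw [hits_add (Nat.zero_le a) h, Nat.mul_add]
    refine Nat.add_le_add (Nat.mul_le_mul_left _ (hle a)) ?_
    refine (Nat.mul_le_mul_right _ (le_max_left S (j + 1))).trans
      ((mul_hits_le_opened rule (by omega) h).trans (opened_mono (Nat.zero_le _) le_rfl))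

theorem strictMono_of_isSkipRule {f : List (ℕ × Bool) → ℕ} (hf : IsSkipRule f) (A : Set ℕ) :
    StrictMono fun n => f (skipPlay f A n) := by
  have key : ∀ n, IsSkipSequence (skipPlay f A n) ∧
      ∀ p ∈ skipPlay f A n, p.1 < f (skipPlay f A n) := by
    intro n
    induction n with
    | zero => simp [skipPlay, IsSkipSequence]
    | succ n ih =>
      have h1 : IsSkipSequence (skipPlay f A (n + 1)) := by
        rw [skipPlay, IsSkipSequence, List.pairwise_append]
        exact ⟨ih.1, by simp, by simpa using fun a b h => ih.2 (a, b) h⟩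
      have h2 : f (skipPlay f A n) < f (skipPlay f A (n + 1)) := by
        have := hf _ h1
        rw [skipPlay] at this ⊢
        simpa using this
      refine ⟨h1, fun p hp => ?_⟩
      rw [skipPlay, List.mem_append, List.mem_singleton] at hp
      rcases hp with hp | rfl
      · exact (ih.2 p hp).trans h2
      · exact h2
  refine strictMono_nat_of_lt_succ fun n => ?_
  have := (key (n + 1)).2
  rw [skipPlay] at this ⊢
  exact this _ (List.mem_append_right _ (List.mem_singleton.2 rfl))

/-- The binary string marking the doors at which a sequence of plays has found cars. -/
def carString (σ : List (ℕ × Bool)) : List Bool :=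
  (List.range (σ.foldr (fun p n => p.1 + n + 1) 0)).map fun d => decide (∃ p ∈ σ, p = (d, true))

theorem mem_ofString_carString {σ : List (ℕ × Bool)} {d : ℕ} :
    d ∈ ofString (carString σ) ↔ (d, true) ∈ σ := by
  have hlt : ∀ {σ : List (ℕ × Bool)} {p : ℕ × Bool}, p ∈ σ →
      p.1 < σ.foldr (fun p n => p.1 + n + 1) 0 := by
    intro σ
    induction σ with
    | nil => simp
    | cons q σ ih =>
      intro p hp
      simp only [List.foldr_cons]
      rcases List.mem_cons.1 hp with rfl | hp
      · omega
      · have := ih hp; omega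
  simp only [ofString, carString, Set.mem_ofPred_eq]
  rcases Nat.lt_or_ge d (σ.foldr (fun p n => p.1 + n + 1) 0) with h | h
  · rw [List.getD_eq_getElem _ _ (by simpa using h)]
    simp
  · rw [List.getD_eq_default _ _ (by simpa using h)]
    simp only [Bool.false_eq_true, false_iff]
    exact fun h' => absurd (hlt h') (by simpa using h)

theorem primrec_carString : Primrec carString := by
  have h1 : Primrec fun σ : List (ℕ × Bool) => σ.foldr (fun p n => p.1 + n + 1) 0 :=
    Primrec.list_foldr Primrec.id (Primrec.const 0)
      (Primrec.succ.comp (Primrec.nat_add.comp (Primrec.fst.comp (Primrec.fst.comp Primrec.snd))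
        (Primrec.snd.comp Primrec.snd))).to₂
  have h2 : PrimrecRel fun (p : ℕ × Bool) (d : ℕ) => p = (d, true) :=
    Primrec.eq.comp Primrec.fst (Primrec.snd.pair (Primrec.const true))
  exact Primrec.list_map (Primrec.list_range.comp h1) h2.exists_mem_list.decide

/-- Along the play, the finite set of cars found so far agrees with `A` on the doors already opened,
so consistency gives the same next door. The resulting function need not increase on sequences that
no host produces, so it need not be a skip rule. -/
theorem skipPlay_of_consistent {g : Set ℕ → ℕ → ℕ} (hg : Consistent g) (A : Set ℕ) (n : ℕ) :
    (fun σ => g (ofString (carString σ)) σ.length)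
      (skipPlay (fun σ => g (ofString (carString σ)) σ.length) A n) = g A n := by
  classical
  set f : List (ℕ × Bool) → ℕ := fun σ => g (ofString (carString σ)) σ.length with hf
  have step : ∀ n, skipPlay f A n = (List.range n).map (fun k => (g A k, decide (g A k ∈ A))) →
      f (skipPlay f A n) = g A n := by
    intro n hn
    simp only [hf, skipPlay_length]
    refine (hg A _ n fun y hy => ?_).symm
    rw [mem_ofString_carString]
    change _ ↔ _ ∈ skipPlay f A n
    rw [hn, List.mem_map]
    constructor
    · exact fun h => ⟨y, List.mem_range.2 hy, by simp [h]⟩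
    · rintro ⟨k, -, hk⟩
      simp only [Prod.mk.injEq, decide_eq_true_eq] at hk
      rw [← hk.1]
      exact hk.2
  refine step n ?_
  induction n with
  | zero => rfl
  | succ n ih => rw [skipPlay, step n ih, ih, List.range_succ, List.map_append]; rfl

theorem beatsContestant_carSet {g : Set ℕ → ℕ → ℕ} (ho : Orderly g) (hc : Consistent g)
    (hg : ComputableContestant g) : BeatsContestant (carSet rule) g := by
  have hf : Computable fun σ : List (ℕ × Bool) => g (ofString (carString σ)) σ.length :=
    hg.comp primrec_carString.to_comp Computable.list_length
  have h := skipPlay_of_consistent hc (carSet rule)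
  have := hasDensity_skipSelect_carSet hf
    (by simpa only [h] using strictMono_nat_of_lt_succ (ho (carSet rule)))
  simpa only [BeatsContestant, skipSelect, h] using this

theorem not_intrinsicallySmall {A : Set ℕ} {f : ℕ → ℕ} (hf : Computable f)
    (hi : Function.Injective f) (h : upperDensity (f ⁻¹' A) = 1) : ¬ IntrinsicallySmall A := by
  rintro ⟨h1, -⟩
  have : (1 : ℝ) ≤ intrinsicUpperDensity A :=
    le_csSup ⟨1, by rintro _ ⟨f, -, -, rfl⟩; exact upperDensity_le_one _⟩ ⟨f, hf, hi, h.symm⟩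
  rw [h1] at this
  norm_num at this

end Stochasticity

theorem mainTheorem5 :
    Computable Stochasticity.blockInjection ∧
    Function.Injective Stochasticity.blockInjection ∧
    ∃ A : Set ℕ,
      A.Infinite ∧
      Stochasticity.SetTuringReducible A Stochasticity.haltingSet ∧
      (∀ g : Set ℕ → ℕ → ℕ, Stochasticity.Orderly g → Stochasticity.Consistent g →
        Stochasticity.ComputableContestant g → Stochasticity.BeatsContestant A g) ∧
      Stochasticity.WeaklyStochastic 0 A ∧
      Stochasticity.upperDensity (Stochasticity.blockInjection ⁻¹' A) = 1 ∧
      ¬ Stochasticity.IntrinsicallySmall A := by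
  have hmiss := Stochasticity.exists_time_miss_carSet Stochasticity.rule
  have hupper := Stochasticity.upperDensity_eq_one hmiss
  exact ⟨Stochasticity.computable_blockInjection, Stochasticity.blockInjection_injective,
    Stochasticity.carSet Stochasticity.rule,
    Stochasticity.infinite_of_miss Stochasticity.blockInjection_injective hmiss,
    Stochasticity.carSet_reducible,
    fun g ho hc hg => Stochasticity.beatsContestant_carSet ho hc hg,
    fun f hf hskip => Stochasticity.hasDensity_skipSelect_carSet hf
      (Stochasticity.strictMono_of_isSkipRule hskip _),
    hupper, Stochasticity.not_intrinsicallySmall Stochasticity.computable_blockInjection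
      Stochasticity.blockInjection_injective hupper⟩
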